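/- Theorem. All rings are commutative with unit (the zero ring is allowed). Let \(R\) be a ring. A homomorphism \(f\colon M\to N\) of \(R\)-modules is called seemingly divisible by \(r\in R\) if \(f(m)=0\) for every \(m\in M\) with \(rm=0\), and \(f(M)\subseteq rN\); it is called divisible by \(r\) if \(f=r\cdot g\) for some \(g\in \mathrm{Hom}_R(M,N)\). (Divisible by \(r\) always implies seemingly divisible by \(r\).) For \(x\in R\), let \(V(x)\subseteq\operatorname{Spec}R\) denote the closed set of prime ideals containing \(x\). The following statements are equivalent: (1) For every \(r\in R\), an \(R\)-module homomorphism is seemingly divisible by \(r\) if and only if it is divisible by \(r\). (2) For every prime ideal \(\mathfrak p\) of \(R\) the localization \(R_{\mathfrak p}\) is a principal ideal ring (a ring in which every ideal is principal), and for every \(x\in R\) there is a decomposition of \(R\) as a product of rings \(R_0\times R_1\times R_2\) (some factors may be zero) such that \(x=(0,x_1,x_2)\), the element \(x_1\in R_1\) is a non-zero divisor for which the subspace \(V(x_1)\subseteq\operatorname{Spec}R_1\) is discrete, and \(R_2\) is a principal ideal ring. (3) For every prime ideal \(\mathfrak p\) of \(R\) the localization \(R_{\mathfrak p}\) is a principal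 ideal ring; every \(\mathfrak p\in\operatorname{Spec}R\) for which \(R_{\mathfrak p}\) is not reduced is an isolated point of \(\operatorname{Spec}R\), i.e. \(\{\mathfrak p\}\) is open; and whenever \(\mathfrak p\in\operatorname{Spec}R\) is an accumulation point of a subset \(S\subseteq\operatorname{Spec}R\setminus\{\mathfrak p\}\) and \(\mathfrak q\subseteq\mathfrak p\) is a prime ideal, then \(\mathfrak q\) is an accumulation point of \(S\) as well. Here a point is called an accumulation point of \(S\) if every open neighbourhood of it meets \(S\) (the point itself being allowed if it lies in \(S\)), i.e. if it lies in the closure of \(S\). -/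

import Mathlib

universe u v

/-- `f` is seemingly divisible by `r`: it kills the `r`-torsion `M[r]` and its image lies in `rN`. -/
def SeeminglyDivisibleBy {R : Type*} [CommRing R] {M N : Type*} [AddCommGroup M] [AddCommGroup N]
    [Module R M] [Module R N] (f : M →ₗ[R] N) (r : R) : Prop :=
  (∀ m : M, r • m = 0 → f m = 0) ∧ ∀ m : M, ∃ n : N, f m = r • n

/-- `f` is divisible by `r` in the `R`-module `Hom_R(M, N)`. -/
def DivisibleInHomBy {R : Type*} [CommRing R] {M N : Type*} [AddCommGroup M] [AddCommGroup N]
    [Module R M] [Module R N] (f : M →ₗ[R] N) (r : R) : Prop :=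
  ∃ g : M →ₗ[R] N, f = r • g

/-- For every `r`, the module homomorphisms seemingly divisible by `r` are exactly those
divisible by `r`. The modules range over an arbitrary universe that is at least that of `R`. -/
def SeeminglyDivisibleEqDivisible (R : Type u) [CommRing R] : Prop :=
  ∀ (r : R) (M N : Type (max u v)) [AddCommGroup M] [AddCommGroup N] [Module R M] [Module R N]
    (f : M →ₗ[R] N), SeeminglyDivisibleBy f r ↔ DivisibleInHomBy f r

/-- Every localization of `R` at a prime ideal is a principal ideal ring. -/
def LocallyPrincipalIdealRing (R : Type u) [CommRing R] : Prop :=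
  ∀ (p : Ideal R) [p.IsPrime], IsPrincipalIdealRing (Localization.AtPrime p)

/-- `R` is a product `R₀ × R₁ × R₂` in which `x = (0, x₁, x₂)`, where `x₁` is a non-zero-divisor
of `R₁`, the subspace `V(x₁)` of `Spec R₁` is discrete, and `R₂` is a principal ideal ring. -/
def HasSplittingAt (R : Type u) [CommRing R] (x : R) : Prop :=
  ∃ (R₀ R₁ R₂ : Type u) (_ : CommRing R₀) (_ : CommRing R₁) (_ : CommRing R₂)
    (e : R ≃+* R₀ × R₁ × R₂) (x₁ : R₁) (x₂ : R₂),
    e x = (0, x₁, x₂) ∧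
    x₁ ∈ nonZeroDivisors R₁ ∧
    DiscreteTopology (PrimeSpectrum.zeroLocus {x₁}) ∧
    IsPrincipalIdealRing R₂

/-- Every point of `Spec R` whose local ring is not reduced is an isolated point. -/
def NonReducedPointsIsolated (R : Type u) [CommRing R] : Prop :=
  ∀ p : PrimeSpectrum R, ¬ IsReduced (Localization.AtPrime p.asIdeal) →
    IsOpen ({p} : Set (PrimeSpectrum R))

/-- `p` is an accumulation point of `S` if every open neighbourhood of `p` meets `S`
(for `p ∉ S` this agrees with `AccPt p (𝓟 S)`). -/
def IsAccumulationPoint {X : Type*} [TopologicalSpace X] (p : X) (S : Set X) : Prop :=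
  ∀ U : Set X, IsOpen U → p ∈ U → (U ∩ S).Nonempty

/-- If `p` is an accumulation point of a set `S` of primes with `p ∉ S`, then so is every
prime `q ⊆ p`. -/
def AccumulationPassesDown (R : Type u) [CommRing R] : Prop :=
  ∀ (p q : PrimeSpectrum R) (S : Set (PrimeSpectrum R)), p ∉ S →
    IsAccumulationPoint p S → q.asIdeal ≤ p.asIdeal → IsAccumulationPoint q S

/-! The implications are (1) → (3) → (1) and (2) ↔ (3).

(1) → (3) evaluates the hypothesis on three test maps. For cyclic modules, multiplication by `r`
from `R ⧸ I` to `R ⧸ (I ⊓ (r))` gives `SeemingDivisorsLift.exists_mul_mem_span`; over a local ring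
this makes divisibility a total preorder. For the direct limit of `R → R → ⋯`, multiplication by `r`
gives `SeemingDivisorsLift.exists_prod_eq`, a chain condition on products modulo `(r) + ann r`. A
map from a countable power of a local ring to a countable direct sum, through the residue field,
excludes a nonzero element killed by a non-nilpotent uniformizer. The property localizes, so these
results together make every local ring a principal ideal ring; the first two, applied globally, give
the topological conditions.

(3) → (1): a lift of `f` through `r` is obtained from the pullback `P` of `f` and `r : N → N`, an
extension of `M` by the `r`-torsion of `N`. Condition (3) makes the locus where `r` vanishes locally
clopen, cut out by an idempotent `e` with `e * r = 0`, and makes the rest of `V(r)` discrete. Away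
from `e` the torsion meets `r • P` trivially and embeds purely modulo `r • P`. Purity is checked at
maximal ideals, where divisibility is total. Over a ring with discrete spectrum and principal local
rings pure submodules split, because every nonzero module has a pure cyclic submodule generated by
an element of maximal order (`exists_isCompl_of_pure`, `exists_pure_cyclic_submodule`). The
projection onto the torsion corrects `P → N` to a map factoring through `M`.

(3) → (2): the points where `x` vanishes locally, and the remaining non-reduced points of `V(x)`,
form disjoint clopen sets, whose idempotents split `R`. (2) → (3) examines which of the three
factors contains the given prime. -/

/-- Homomorphisms of modules in the universe of `R` that are seemingly divisible are divisible. -/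
def SeemingDivisorsLift (R : Type u) [CommRing R] : Prop :=
  ∀ (r : R) (M N : Type u) [AddCommGroup M] [AddCommGroup N] [Module R M] [Module R N]
    (f : M →ₗ[R] N), SeeminglyDivisibleBy f r → DivisibleInHomBy f r

/-- All test modules used below live in the universe of `R`; `ULift` carries them to the universe of
the hypothesis. -/
theorem SeeminglyDivisibleEqDivisible.seemingDivisorsLift {R : Type u} [CommRing R]
    (h : SeeminglyDivisibleEqDivisible.{u, v} R) : SeemingDivisorsLift R := by
  intro r M N _ _ _ _ f hf
  let eM : ULift.{v} M ≃ₗ[R] M := ULift.moduleEquiv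
  let eN : ULift.{v} N ≃ₗ[R] N := ULift.moduleEquiv
  obtain ⟨g, hg⟩ := (h r (ULift.{v} M) (ULift.{v} N)
    (eN.symm.toLinearMap ∘ₗ f ∘ₗ eM.toLinearMap)).1 (by
      refine ⟨fun m hm => ?_, fun m => ?_⟩
      · have : f (eM m) = 0 := hf.1 _ (by rw [← map_smul, hm, map_zero])
        simp [this]
      · obtain ⟨n, hn⟩ := hf.2 (eM m)
        exact ⟨eN.symm n, by simp [hn]⟩)
  refine ⟨eN.toLinearMap ∘ₗ g ∘ₗ eM.symm.toLinearMap, LinearMap.ext fun m => ?_⟩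
  have := congrArg eN (LinearMap.congr_fun hg (eM.symm m))
  simpa using this

/-! ### Localization and cyclic test modules -/

namespace SeemingDivisorsLift

variable {R : Type u} [CommRing R]

/-- A fraction `a / s` differs from `a` by a unit, and `R`-linear maps between modules over the
localization are linear over it. -/
theorem localization (h : SeemingDivisorsLift R) (S : Submonoid R) :
    SeemingDivisorsLift (Localization S) := by
  intro r M N _ _ _ _ f hf
  let _ : Module R M := Module.compHom M (algebraMap R (Localization S))
  let _ : Module R N := Module.compHom N (algebraMap R (Localization S))
  have : IsScalarTower R (Localization S) M :=
    IsScalarTower.of_algebraMap_smul fun _ _ => rfl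
  have : IsScalarTower R (Localization S) N :=
    IsScalarTower.of_algebraMap_smul fun _ _ => rfl
  obtain ⟨a, s, rfl⟩ := IsLocalization.exists_mk'_eq S r
  have hs : IsUnit (algebraMap R (Localization S) s) := IsLocalization.map_units _ s
  have ha : algebraMap R (Localization S) a =
      algebraMap R (Localization S) s * IsLocalization.mk' (Localization S) a s :=
    (IsLocalization.mk'_spec' _ _ _).symm
  obtain ⟨g, hg⟩ := h a M N (f.restrictScalars R) (by
    refine ⟨fun m hm => hf.1 m ?_, fun m => ?_⟩
    · rw [← algebraMap_smul (Localization S), ha, mul_smul] at hm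
      exact (hs.smul_eq_zero).1 hm
    · obtain ⟨n, hn⟩ := hf.2 m
      obtain ⟨t, ht⟩ := hs
      refine ⟨(↑t⁻¹ : Localization S) • n, ?_⟩
      rw [← algebraMap_smul (Localization S), ha, ← ht, smul_smul, mul_right_comm,
        Units.mul_inv, one_mul]
      exact hn)
  refine ⟨algebraMap R (Localization S) s • LinearMap.extendScalarsOfIsLocalization S _ g,
    LinearMap.ext fun m => ?_⟩
  have := LinearMap.congr_fun hg m
  simp only [LinearMap.restrictScalars_apply, LinearMap.smul_apply] at this
  rw [this, LinearMap.smul_apply, LinearMap.smul_apply, smul_smul, mul_comm, ← ha,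
    algebraMap_smul]
  rfl

/-- Divisibility for maps out of the cyclic module `R ⧸ I`. -/
theorem exists_mul_mem_span (h : SeemingDivisorsLift R) (I : Ideal R) (r : R) :
    ∃ u, (u - 1) * r ∈ I ∧ ∀ i ∈ I, r ∣ u * i := by
  -- Intersecting with `(r)` costs nothing for torsion, since `r * a ∈ I` already implies `r * a ∈
  -- K`. It forces `u * i ∈ (r)` for any `u` representing the image of `1` under a quotient map.
  let K : Ideal R := I ⊓ Ideal.span {r}
  have hK : I ≤ Submodule.comap (LinearMap.mulLeft R r) K := fun i hi =>
    ⟨I.mul_mem_left r hi, Ideal.mem_span_singleton.2 (dvd_mul_right r i)⟩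
  obtain ⟨g, hg⟩ := h r (R ⧸ I) (R ⧸ K) (Submodule.mapQ I K (LinearMap.mulLeft R r) hK) (by
    refine ⟨fun m hm => ?_, fun m => ?_⟩
    · obtain ⟨a, rfl⟩ := Submodule.Quotient.mk_surjective _ m
      rw [← Submodule.Quotient.mk_smul, Submodule.Quotient.mk_eq_zero, smul_eq_mul] at hm
      rw [Submodule.mapQ_apply, Submodule.Quotient.mk_eq_zero]
      exact ⟨hm, Ideal.mem_span_singleton.2 (dvd_mul_right r a)⟩
    · obtain ⟨a, rfl⟩ := Submodule.Quotient.mk_surjective _ m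
      exact ⟨Submodule.Quotient.mk a, rfl⟩)
  obtain ⟨u, hu⟩ := Submodule.Quotient.mk_surjective _ (g (Submodule.Quotient.mk 1))
  refine ⟨u, ?_, fun i hi => ?_⟩
  · have := LinearMap.congr_fun hg (Submodule.Quotient.mk 1)
    rw [LinearMap.smul_apply, ← hu, Submodule.mapQ_apply, ← Submodule.Quotient.mk_smul,
      Submodule.Quotient.eq] at this
    have h1 := I.neg_mem this.1
    have h2 : -(r • (1 : R) - r • u) = (u - 1) * r := by simp only [smul_eq_mul]; ring
    rwa [← h2]
  · have : g (Submodule.Quotient.mk (i • 1)) = 0 := by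
      rw [smul_eq_mul, mul_one, (Submodule.Quotient.mk_eq_zero I).2 hi, map_zero]
    rw [Submodule.Quotient.mk_smul, map_smul, ← hu, ← Submodule.Quotient.mk_smul,
      Submodule.Quotient.mk_eq_zero] at this
    rw [mul_comm]
    exact Ideal.mem_span_singleton.1 this.2

end SeemingDivisorsLift

/-! ### Direct limits of copies of the ring -/

/-- The relations `e n = a n • e (n + 1)` presenting the direct limit of `R → R → R → ⋯` with
transition maps `a n`. -/
noncomputable def bassRelation {R : Type u} [CommRing R] (a : ℕ → R) : (ℕ →₀ R) →ₗ[R] (ℕ →₀ R) :=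
  Finsupp.linearCombination R fun n => Finsupp.single n 1 - Finsupp.single (n + 1) (a n)

section Bass

variable {R : Type u} [CommRing R] (a : ℕ → R)

theorem bassRelation_single (n : ℕ) :
    bassRelation a (Finsupp.single n 1) = Finsupp.single n 1 - Finsupp.single (n + 1) (a n) := by
  simp [bassRelation]

theorem bassRelation_apply_zero (y : ℕ →₀ R) : bassRelation a y 0 = y 0 := by
  have : (Finsupp.lapply 0 ∘ₗ bassRelation a : (ℕ →₀ R) →ₗ[R] R) = Finsupp.lapply 0 := by
    refine Finsupp.lhom_ext' fun n => LinearMap.ext_ring ?_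
    simp [bassRelation_single]
  exact LinearMap.congr_fun this y

theorem bassRelation_apply_succ (y : ℕ →₀ R) (m : ℕ) :
    bassRelation a y (m + 1) = y (m + 1) - a m * y m := by
  have : (Finsupp.lapply (m + 1) ∘ₗ bassRelation a : (ℕ →₀ R) →ₗ[R] R) =
      Finsupp.lapply (m + 1) - a m • Finsupp.lapply m := by
    refine Finsupp.lhom_ext' fun n => LinearMap.ext_ring ?_
    by_cases hn : n = m
    · subst hn; simp [bassRelation_single]
    · simp [bassRelation_single, Finsupp.single_apply, hn]
  exact LinearMap.congr_fun this y

theorem Finsupp.exists_eq_smul_of_forall_dvd {ι : Type*} {r : R} {y : ι →₀ R}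
    (h : ∀ i, r ∣ y i) : ∃ z : ι →₀ R, y = r • z := by
  have : y ∈ LinearMap.range (r • (LinearMap.id : (ι →₀ R) →ₗ[R] (ι →₀ R))) := by
    rw [← Finsupp.sum_single y]
    refine Submodule.sum_mem _ fun i _ => ?_
    obtain ⟨c, hc⟩ := h i
    exact ⟨Finsupp.single i c, by simp [hc]⟩
  obtain ⟨z, hz⟩ := this
  exact ⟨z, by simpa using hz.symm⟩

theorem dvd_of_bassRelation_eq_smul {r : R} {x y : ℕ →₀ R} (h : bassRelation a y = r • x) (n : ℕ) :
    r ∣ y n := by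
  induction n with
  | zero =>
    rw [← bassRelation_apply_zero a y, h]
    exact ⟨x 0, rfl⟩
  | succ n ih =>
    have := bassRelation_apply_succ a y n
    rw [h, eq_sub_iff_add_eq] at this
    rw [← this]
    exact dvd_add ⟨x (n + 1), rfl⟩ (ih.mul_left _)

/-- The products of a sequence stabilize modulo `(r) + ann r`. -/
theorem SeemingDivisorsLift.exists_prod_eq (h : SeemingDivisorsLift R) (r : R) :
    ∃ L, ∀ n, ∃ c d t, r * t = 0 ∧
      ∏ i ∈ Finset.range L, a i = (∏ i ∈ Finset.range n, a i) * c + r * d + t := by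
  let φ := bassRelation a
  let K : Submodule R (ℕ →₀ R) := LinearMap.range φ
  -- The target is divided only by `r` times the relations. If `r • x = φ y`, then `r` divides all
  -- coordinates of `y`, so `r • x` is such a multiple and the torsion condition holds.
  let K' : Submodule R (ℕ →₀ R) := LinearMap.range (r • φ)
  have hK : K ≤ K'.comap (r • LinearMap.id) := by
    rintro _ ⟨y, rfl⟩
    exact ⟨y, rfl⟩
  obtain ⟨g, hg⟩ := h r ((ℕ →₀ R) ⧸ K) ((ℕ →₀ R) ⧸ K') (Submodule.mapQ K K' _ hK) (by
    refine ⟨fun m hm => ?_, fun m => ?_⟩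
    · obtain ⟨x, rfl⟩ := Submodule.Quotient.mk_surjective _ m
      rw [← Submodule.Quotient.mk_smul, Submodule.Quotient.mk_eq_zero] at hm
      obtain ⟨y, hy⟩ := hm
      obtain ⟨z, rfl⟩ := Finsupp.exists_eq_smul_of_forall_dvd (dvd_of_bassRelation_eq_smul a hy)
      rw [Submodule.mapQ_apply, Submodule.Quotient.mk_eq_zero]
      refine ⟨z, ?_⟩
      rw [LinearMap.smul_apply, ← map_smul, hy]
      rfl
    · obtain ⟨x, rfl⟩ := Submodule.Quotient.mk_surjective _ m
      exact ⟨Submodule.Quotient.mk x, rfl⟩)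
  choose v hv using fun n : ℕ =>
    Submodule.Quotient.mk_surjective _ (g (Submodule.Quotient.mk (Finsupp.single n 1)))
  have hstep : ∀ n, g (Submodule.Quotient.mk (Finsupp.single n 1)) =
      a n • g (Submodule.Quotient.mk (Finsupp.single (n + 1) 1)) := fun n => by
    rw [← map_smul, ← Submodule.Quotient.mk_smul]
    congr 1
    rw [Submodule.Quotient.eq]
    exact ⟨Finsupp.single n 1, by simp [φ, bassRelation_single]⟩
  have hprod : ∀ n, g (Submodule.Quotient.mk (Finsupp.single 0 1)) =
      (∏ i ∈ Finset.range n, a i) • g (Submodule.Quotient.mk (Finsupp.single n 1)) := fun n => by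
    induction n with
    | zero => simp
    | succ n ih => rw [ih, hstep n, smul_smul, Finset.prod_range_succ]
  obtain ⟨y, hy⟩ : ∃ y, r • φ y = r • v 0 - r • Finsupp.single 0 1 := by
    have := LinearMap.congr_fun hg (Submodule.Quotient.mk (Finsupp.single 0 1))
    rw [LinearMap.smul_apply, ← hv, Submodule.mapQ_apply, ← Submodule.Quotient.mk_smul, eq_comm,
      Submodule.Quotient.eq] at this
    exact this
  obtain ⟨L, hL⟩ : ∃ L, ∀ j ∈ y.support, j < L :=
    ⟨y.support.sup id + 1, fun j hj => Nat.lt_succ_of_le (Finset.le_sup (f := id) hj)⟩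
  -- The map to stage `L` of the direct system, set to zero past `L`. It kills the relations with
  -- index below `L`, which include all those occurring in `φ y`.
  let ψ : (ℕ →₀ R) →ₗ[R] R := Finsupp.linearCombination R fun j =>
    if j ≤ L then ∏ i ∈ Finset.Ico j L, a i else 0
  have hψ : ψ (φ y) = 0 := by
    have hφ : φ y = ∑ j ∈ y.support, y j • (Finsupp.single j 1 - Finsupp.single (j + 1) (a j)) :=
      Finsupp.linearCombination_apply R y
    rw [hφ, map_sum]
    refine Finset.sum_eq_zero fun j hj => ?_
    have hj' := hL j hj
    rw [map_smul]
    simp [ψ, hj'.le, Nat.succ_le_of_lt hj', Finset.prod_eq_prod_Ico_succ_bot hj']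
  refine ⟨L, fun n => ?_⟩
  obtain ⟨w, hw⟩ : ∃ w, r • φ w = v 0 - (∏ i ∈ Finset.range n, a i) • v n := by
    have := hprod n
    rw [← hv, ← hv, ← Submodule.Quotient.mk_smul, Submodule.Quotient.eq] at this
    exact this
  refine ⟨ψ (v n), ψ (φ w), - ψ (v 0 - Finsupp.single 0 1 - φ y), ?_, ?_⟩
  · rw [mul_neg, ← smul_eq_mul, ← map_smul, smul_sub, smul_sub, ← hy, sub_self, map_zero, neg_zero]
  · have h1 : r * ψ (φ w) = ψ (v 0) - (∏ i ∈ Finset.range n, a i) * ψ (v n) := by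
      rw [← smul_eq_mul, ← map_smul, hw, map_sub, map_smul, smul_eq_mul]
    rw [h1, map_sub, map_sub, hψ]
    have h2 : ψ (Finsupp.single 0 1) = ∏ i ∈ Finset.range L, a i := by
      rw [Finset.range_eq_Ico]
      simp only [ψ, Finsupp.linearCombination_single, zero_le, if_true, one_smul]
    rw [h2]
    ring

end Bass

/-! ### Local rings -/

theorem isPrincipalIdealRing_of_associated_pow {R : Type*} [CommRing R] (π : R)
    (h : ∀ a : R, a ≠ 0 → ∃ k : ℕ, Associated a (π ^ k)) : IsPrincipalIdealRing R := by
  classical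
  refine ⟨fun I => ?_⟩
  by_cases hI : I = ⊥
  · exact hI ▸ bot_isPrincipal
  · obtain ⟨a, ha, ha0⟩ := Submodule.exists_mem_ne_zero_of_ne_bot hI
    have hex : ∃ k, π ^ k ∈ I := by
      obtain ⟨k, hk⟩ := h a ha0
      exact ⟨k, I.mem_of_dvd hk.dvd ha⟩
    refine ⟨⟨π ^ Nat.find hex, le_antisymm (fun b hb => ?_)
      ((Ideal.span_singleton_le_iff_mem I).2 (Nat.find_spec hex))⟩⟩
    by_cases hb0 : b = 0
    · exact hb0 ▸ zero_mem _
    · obtain ⟨k, hk⟩ := h b hb0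
      exact Ideal.mem_span_singleton.2 ((pow_dvd_pow π
        (Nat.find_min' hex (I.mem_of_dvd hk.dvd hb))).trans hk.symm.dvd)

theorem IsLocalRing.associated_pow_of_not_mem_iInf {R : Type*} [CommRing R] [IsLocalRing R] {π a : R}
    (hπ : IsLocalRing.maximalIdeal R = Ideal.span {π}) (ha : ∃ k, ¬ π ^ k ∣ a) :
    ∃ k : ℕ, Associated a (π ^ k) := by
  classical
  obtain ⟨k, hk⟩ : ∃ k, Nat.find ha = k + 1 :=
    Nat.exists_eq_succ_of_ne_zero fun h0 => Nat.find_spec ha (by simp [h0])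
  obtain ⟨c, hc⟩ : π ^ k ∣ a := not_not.1 (Nat.find_min ha (by lia))
  have hcu : IsUnit c := by
    by_contra hcu
    have : c ∈ Ideal.span {π} := hπ ▸ (IsLocalRing.mem_maximalIdeal c).2 hcu
    obtain ⟨d, rfl⟩ := Ideal.mem_span_singleton.1 this
    exact Nat.find_spec ha ⟨d, by rw [hk, hc]; ring⟩
  obtain ⟨u, rfl⟩ := hcu
  exact ⟨k, Associated.symm ⟨u, hc.symm⟩⟩

theorem IsLocalRing.exists_associated_pow (R : Type*) [CommRing R] [IsLocalRing R]
    [IsPrincipalIdealRing R] :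
    ∃ π : R, IsLocalRing.maximalIdeal R = Ideal.span {π} ∧
      ∀ a : R, a ≠ 0 → ∃ k : ℕ, Associated a (π ^ k) := by
  obtain ⟨π, hπ⟩ := IsPrincipalIdealRing.principal (IsLocalRing.maximalIdeal R)
  refine ⟨π, hπ, fun a ha => IsLocalRing.associated_pow_of_not_mem_iInf hπ ?_⟩
  by_contra! hall
  have : a ∈ ⨅ n, (IsLocalRing.maximalIdeal R) ^ n := by
    refine (Submodule.mem_iInf _).2 fun n => ?_
    rw [hπ, Ideal.submodule_span_eq, Ideal.span_singleton_pow]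
    exact Ideal.mem_span_singleton.2 (hall n)
  rw [Ideal.iInf_pow_eq_bot_of_isLocalRing _ (IsLocalRing.maximalIdeal.isMaximal R).ne_top] at this
  exact ha this

namespace SeemingDivisorsLift

variable {R : Type u} [CommRing R]

/-- The cyclic test with `I = (b)` and `r = a` gives `a ∣ u * b` and `b ∣ (u - 1) * a`, and one of
`u`, `1 - u` is a unit. -/
theorem dvd_total [IsLocalRing R] (h : SeemingDivisorsLift R) (a b : R) : a ∣ b ∨ b ∣ a := by
  obtain ⟨u, hu, hub⟩ := h.exists_mul_mem_span (Ideal.span {b}) a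
  have hub := hub b (Ideal.mem_span_singleton_self b)
  have hu := Ideal.mem_span_singleton.1 hu
  rcases IsLocalRing.isUnit_or_isUnit_one_sub_self u with h1 | h1
  · exact Or.inl ((h1.dvd_mul_left).1 hub)
  · refine Or.inr (((h1.neg).dvd_mul_left).1 ?_)
    rwa [neg_sub]

/-- Totality of divisibility and `r * r ≠ 0` put the annihilator of `r` inside `(r)`. Comparing the
products of lengths `L` and `L + 1` then leaves the unit `1 - a L * c` as a factor. -/
theorem exists_prod_dvd [IsLocalRing R] (h : SeemingDivisorsLift R) {r : R} (hr : r * r ≠ 0)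
    (a : ℕ → R) (ha : ∀ n, a n ∈ IsLocalRing.maximalIdeal R) :
    ∃ L, r ∣ ∏ i ∈ Finset.range L, a i := by
  obtain ⟨L, hL⟩ := h.exists_prod_eq a r
  obtain ⟨c, d, t, ht, hLt⟩ := hL (L + 1)
  obtain ⟨t, rfl⟩ : r ∣ t := by
    rcases h.dvd_total r t with h1 | ⟨s, hs⟩
    · exact h1
    · refine absurd ?_ hr
      nth_rewrite 2 [hs]
      rw [← mul_assoc, ht, zero_mul]
  refine ⟨L, ?_⟩
  have hu : IsUnit (1 - a L * c) := by
    rcases IsLocalRing.isUnit_or_isUnit_one_sub_self (a L * c) with h1 | h1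
    · exact absurd (isUnit_of_mul_isUnit_left h1) ((IsLocalRing.mem_maximalIdeal _).1 (ha L))
    · exact h1
  refine (hu.dvd_mul_right).1 ⟨d + t, ?_⟩
  rw [Finset.prod_range_succ] at hLt
  linear_combination hLt

/-- If no generator exists, each element of the maximal ideal is a product of two others. Splitting
some `c` not divisible by `r` again and again yields ever longer products dividing `c`, and `r`
eventually divides one of them. -/
theorem exists_maximalIdeal_eq_span [IsLocalRing R] (h : SeemingDivisorsLift R) :
    ∃ π : R, IsLocalRing.maximalIdeal R = Ideal.span {π} := by
  by_contra! hm
  have hsplit : ∀ s ∈ IsLocalRing.maximalIdeal R, ∃ x ∈ IsLocalRing.maximalIdeal R,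
      ∃ y ∈ IsLocalRing.maximalIdeal R, s = x * y := fun s hs => by
    obtain ⟨x, hx, hxs⟩ : ∃ x ∈ IsLocalRing.maximalIdeal R, ¬ s ∣ x := by
      by_contra! hall
      exact hm s (le_antisymm (fun x hx => Ideal.mem_span_singleton.2 (hall x hx))
        ((Ideal.span_singleton_le_iff_mem _).2 hs))
    obtain ⟨y, rfl⟩ := (h.dvd_total s x).resolve_left hxs
    refine ⟨x, hx, y, (IsLocalRing.mem_maximalIdeal _).2 fun hy => hxs ?_, rfl⟩
    exact (hy.mul_right_dvd).2 dvd_rfl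
  have hne : IsLocalRing.maximalIdeal R ≠ ⊥ := fun h0 => hm 0 (by simpa using h0)
  obtain ⟨r, hr, hr0⟩ : ∃ r ∈ IsLocalRing.maximalIdeal R, r * r ≠ 0 := by
    obtain ⟨s, hs, hs0⟩ := Submodule.exists_mem_ne_zero_of_ne_bot hne
    obtain ⟨x, hx, y, hy, rfl⟩ := hsplit s hs
    rcases h.dvd_total x y with ⟨c, rfl⟩ | ⟨c, rfl⟩
    · exact ⟨x, hx, fun h0 => hs0 (by linear_combination c * h0)⟩
    · exact ⟨y, hy, fun h0 => hs0 (by linear_combination c * h0)⟩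
  obtain ⟨c, hc, hrc⟩ : ∃ x ∈ IsLocalRing.maximalIdeal R, ¬ r ∣ x := by
    by_contra! hall
    exact hm r (le_antisymm (fun x hx => Ideal.mem_span_singleton.2 (hall x hx))
      ((Ideal.span_singleton_le_iff_mem _).2 hr))
  choose x hx y hy hxy using hsplit
  let C : ℕ → IsLocalRing.maximalIdeal R :=
    fun n => Nat.rec ⟨c, hc⟩ (fun _ s => ⟨y s.1 s.2, hy s.1 s.2⟩) n
  have hC : ∀ n, c = (∏ i ∈ Finset.range n, x (C i).1 (C i).2) * (C n).1 := fun n => by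
    induction n with
    | zero => simp [C]
    | succ n ih =>
      rw [Finset.prod_range_succ, mul_assoc]
      exact ih.trans (congrArg _ (hxy (C n).1 (C n).2))
  obtain ⟨L, hL⟩ := h.exists_prod_dvd hr0 (fun n => x (C n).1 (C n).2) fun n => hx _ _
  exact hrc (hC L ▸ hL.mul_right _)

end SeemingDivisorsLift

/-- A linear map from a countable product of copies of a local ring with non-nilpotent
principal maximal ideal to a free module cannot map the standard vectors to the standard basis
modulo the maximal ideal. -/
theorem not_exists_linearMap_pi_finsupp {R : Type*} [CommRing R] [IsLocalRing R] {π : R}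
    (hπ : π ∈ IsLocalRing.maximalIdeal R) (hn : ¬ IsNilpotent π)
    (g : (ℕ → R) →ₗ[R] (ℕ →₀ R))
    (hg : ∀ n, IsUnit (g (Pi.single n 1) n)) : False := by
  classical
  let B : ℕ → ℕ := fun j => (Finset.range (j + 1)).sup fun i =>
    (g (Pi.single i 1)).support.sup id
  -- Gliding hump: `J (n + 1)` lies beyond the supports of the images of all standard vectors with
  -- index up to `J n`.
  obtain ⟨J, hJ⟩ : ∃ J : ℕ → ℕ, ∀ n, J (n + 1) = B (J n) + J n + 1 :=
    ⟨fun n => Nat.rec (motive := fun _ => ℕ) 0 (fun _ j => B j + j + 1) n, fun n => rfl⟩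
  have hmono : StrictMono J := strictMono_nat_of_lt_succ fun n => by rw [hJ]; lia
  have hsupp : ∀ m n, m < n → g (Pi.single (J m) 1) (J n) = 0 := by
    intro m n hmn
    obtain ⟨n, rfl⟩ : ∃ n', n = n' + 1 := ⟨n - 1, by lia⟩
    by_contra hne
    have h1 : J (n + 1) ≤ (g (Pi.single (J m) 1)).support.sup id :=
      Finset.le_sup (f := id) (Finsupp.mem_support_iff.2 hne)
    have h2 : (g (Pi.single (J m) 1)).support.sup id ≤ B (J n) :=
      Finset.le_sup (f := fun i => (g (Pi.single i 1)).support.sup id)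
        (Finset.mem_range.2 (Nat.lt_succ_of_le (hmono.monotone (by lia))))
    rw [hJ] at h1
    lia
  -- This is the formal sum of `π ^ (n - m)` times the standard vector at `J n`, over `n ≥ m`.
  let tail : ℕ → ℕ → R := fun m j => if m ≤ Function.invFun J j ∧ J (Function.invFun J j) = j then
    π ^ (Function.invFun J j - m) else 0
  have hchoose : ∀ n, Function.invFun J (J n) = n :=
    Function.leftInverse_invFun hmono.injective
  have htail : ∀ m, tail m = Pi.single (J m) 1 + π • tail (m + 1) := by
    intro m
    funext j
    by_cases hj : ∃ n, J n = j
    · obtain ⟨n, rfl⟩ := hj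
      simp only [tail, Pi.add_apply, Pi.smul_apply, smul_eq_mul, hchoose, and_true]
      rcases lt_trichotomy m n with h | h | h
      · rw [if_pos h.le, if_pos (by lia), Pi.single_eq_of_ne (hmono.injective.ne h.ne'), zero_add,
          ← pow_succ']
        congr 1
        lia
      · subst h
        simp
      · rw [if_neg (by lia), if_neg (by lia), Pi.single_eq_of_ne (hmono.injective.ne h.ne)]
        simp
    · have e : J (Function.invFun J j) ≠ j := fun hk => hj ⟨_, hk⟩
      have : j ≠ J m := fun h => hj ⟨m, h.symm⟩
      simp [tail, e, this]
  have hx : ∀ m, tail 0 = (∑ n ∈ Finset.range m, π ^ n • Pi.single (J n) 1) + π ^ m • tail m := by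
    intro m
    induction m with
    | zero => simp
    | succ m ih =>
      rw [ih, Finset.sum_range_succ, htail m, smul_add, smul_smul, ← pow_succ, add_assoc]
  -- At coordinate `J n` the earlier terms vanish by sparseness and the later ones contribute
  -- multiples of `π ^ (n + 1)`, leaving `π ^ n` times a unit.
  have hne : ∀ n, g (tail 0) (J n) ≠ 0 := by
    intro n h0
    rw [hx n, htail n, map_add, map_sum, Finsupp.add_apply, Finsupp.finsetSum_apply,
      Finset.sum_eq_zero fun m hm => ?_, zero_add, map_smul, map_add, map_smul] at h0
    · rw [Finsupp.smul_apply, Finsupp.add_apply, Finsupp.smul_apply, smul_eq_mul, smul_eq_mul] at h0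
      have hu : IsUnit (g (Pi.single (J n) 1) (J n) + π * g (tail (n + 1)) (J n)) := by
        by_contra hnu
        have := (IsLocalRing.maximalIdeal R).sub_mem ((IsLocalRing.mem_maximalIdeal _).2 hnu)
          ((IsLocalRing.maximalIdeal R).mul_mem_right (g (tail (n + 1)) (J n)) hπ)
        rw [add_sub_cancel_right] at this
        exact (IsLocalRing.mem_maximalIdeal _).1 this (hg _)
      exact hn ⟨n, (hu.mul_left_eq_zero).1 h0⟩
    · rw [map_smul, Finsupp.smul_apply, hsupp m n (Finset.mem_range.1 hm), smul_zero]
  exact Set.infinite_of_injective_forall_mem hmono.injective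
    (fun n => Finset.mem_coe.2 (Finsupp.mem_support_iff.2 (hne n))) (Finset.finite_toSet _)

namespace SeemingDivisorsLift

variable {R : Type u} [CommRing R]

theorem isNilpotent_of_annihilated [IsLocalRing R] (h : SeemingDivisorsLift R) {π s : R}
    (hπ : IsLocalRing.maximalIdeal R = Ideal.span {π}) (hs : s ≠ 0) (hsπ : π * s = 0) :
    IsNilpotent π := by
  classical
  by_contra hn
  let k := IsLocalRing.ResidueField R
  have hsm : ∀ a ∈ IsLocalRing.maximalIdeal R, a * s = 0 := fun a ha => by
    rw [hπ] at ha
    obtain ⟨c, rfl⟩ := Ideal.mem_span_singleton.1 ha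
    rw [mul_right_comm, hsπ, zero_mul]
  have hsu : ∀ a, a * s = 0 → a ∈ IsLocalRing.maximalIdeal R := fun a ha =>
    (IsLocalRing.mem_maximalIdeal a).2 fun hu => hs ((hu.mul_right_eq_zero).1 ha)
  let incl : (ℕ →₀ k) →ₗ[k] (ℕ → k) := Finsupp.lcoeFun
  obtain ⟨ret, hret⟩ := LinearMap.exists_leftInverse_of_injective incl
    (LinearMap.ker_eq_bot.2 DFunLike.coe_injective)
  let red : (ℕ → R) →ₗ[R] (ℕ → k) := LinearMap.compLeft (Algebra.linearMap R k) ℕ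
  let σ : k →ₗ[R] R := Submodule.liftQ _ (LinearMap.mulRight R s) hsm
  have hσ : ∀ a, σ (IsLocalRing.residue R a) = a * s := fun a => rfl
  -- Reduce to the residue field, apply a vector space retraction of the direct sum in the product,
  -- and embed each copy of `k` as `s * R`, which is possible because `s` is killed exactly by the
  -- maximal ideal.
  let f : (ℕ → R) →ₗ[R] (ℕ →₀ R) :=
    Finsupp.mapRange.linearMap σ ∘ₗ (ret.restrictScalars R) ∘ₗ red
  obtain ⟨g, hg⟩ := h s (ℕ → R) (ℕ →₀ R) f (by
    refine ⟨fun m hm => ?_, fun m => ?_⟩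
    · have : red m = 0 := funext fun j =>
        (IsLocalRing.residue_eq_zero_iff _).2 (hsu _ (by
          rw [mul_comm]
          exact congrFun hm j))
      simp [f, this]
    · obtain ⟨z, hz⟩ := Finsupp.exists_eq_smul_of_forall_dvd (r := s) (y := f m) fun i => by
        obtain ⟨a, ha⟩ := IsLocalRing.residue_surjective (ret (red m) i)
        have : f m i = σ (ret (red m) i) := rfl
        rw [this, ← ha, hσ]
        exact dvd_mul_left s a
      exact ⟨z, hz⟩)
  refine not_exists_linearMap_pi_finsupp (π := π) (hπ ▸ Ideal.mem_span_singleton_self π) hn g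
    fun n => ?_
  have h1 : red (Pi.single n 1) = incl (Finsupp.single n 1) := by
    funext j
    change IsLocalRing.residue R ((Pi.single n 1 : ℕ → R) j) = Finsupp.single n (1 : k) j
    by_cases hj : n = j
    · subst hj; simp
    · rw [Finsupp.single_eq_of_ne (Ne.symm hj), Pi.single_eq_of_ne (Ne.symm hj), map_zero]
  have h2 : f (Pi.single n 1) n = s := by
    change σ (ret (red (Pi.single n 1)) n) = s
    rw [h1, ← LinearMap.comp_apply, hret, LinearMap.id_apply, Finsupp.single_eq_same,
      ← map_one (IsLocalRing.residue R), hσ, one_mul]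
  have h3 : s * g (Pi.single n 1) n = s := by
    conv_rhs => rw [← h2, hg]
    rfl
  by_contra hnu
  have := hsm _ ((IsLocalRing.mem_maximalIdeal _).2 hnu)
  rw [mul_comm, h3] at this
  exact hs this

/-- It remains to exclude a nonzero `s` divisible by all powers of `π`. If `s * s ≠ 0`, some `π ^ M`
is a multiple of `s`, hence of `π ^ (M + 1)`, so `π` is nilpotent. If `s * s = 0`, the chain
condition kills `s` by a power of `π`, and the last nonzero `π ^ j * s` is annihilated by `π`. -/
theorem isPrincipalIdealRing_of_isLocalRing [IsLocalRing R] (h : SeemingDivisorsLift R) :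
    IsPrincipalIdealRing R := by
  obtain ⟨π, hπ⟩ := h.exists_maximalIdeal_eq_span
  refine isPrincipalIdealRing_of_associated_pow π fun s hs =>
    IsLocalRing.associated_pow_of_not_mem_iInf hπ ?_
  by_contra! hall
  have hn : ¬ IsNilpotent π := fun ⟨n, hn⟩ => hs (zero_dvd_iff.1 (hn ▸ hall n))
  obtain ⟨L, hL⟩ := h.exists_prod_eq (fun _ => π) s
  obtain ⟨c, d, t, ht, hLt⟩ := hL (L + 1)
  simp only [Finset.prod_const, Finset.card_range] at hLt
  have hu : IsUnit (1 - π * c) := by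
    rcases IsLocalRing.isUnit_or_isUnit_one_sub_self (π * c) with h1 | h1
    · exact absurd (isUnit_of_mul_isUnit_left h1) ((IsLocalRing.mem_maximalIdeal _).1
        (hπ ▸ Ideal.mem_span_singleton_self π))
    · exact h1
  obtain ⟨L', hL'⟩ : ∃ L', π ^ L' * s = 0 := by
    by_cases hss : s * s = 0
    · refine ⟨L, (hu.mul_right_eq_zero).1 ?_⟩
      linear_combination s * hLt + d * hss + ht
    · exfalso
      obtain ⟨M, hM⟩ := h.exists_prod_dvd hss (fun _ => π) fun _ =>
        hπ ▸ Ideal.mem_span_singleton_self π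
      simp only [Finset.prod_const, Finset.card_range] at hM
      obtain ⟨q, hq⟩ := (hall (M + 1)).trans hM
      have hu' : IsUnit (1 - π * q) := by
        rcases IsLocalRing.isUnit_or_isUnit_one_sub_self (π * q) with h1 | h1
        · exact absurd (isUnit_of_mul_isUnit_left h1) ((IsLocalRing.mem_maximalIdeal _).1
            (hπ ▸ Ideal.mem_span_singleton_self π))
        · exact h1
      exact hn ⟨M, (hu'.mul_right_eq_zero).1 (by linear_combination hq)⟩
  classical
  have hex : ∃ L', π ^ L' * s = 0 := ⟨L', hL'⟩
  obtain ⟨j, hj⟩ : ∃ j, Nat.find hex = j + 1 :=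
    Nat.exists_eq_succ_of_ne_zero fun h0 => hs (by simpa [h0] using Nat.find_spec hex)
  refine hn (h.isNilpotent_of_annihilated hπ (s := π ^ j * s) (Nat.find_min hex (by lia)) ?_)
  have := Nat.find_spec hex
  rw [hj] at this
  linear_combination this

theorem locallyPrincipalIdealRing (h : SeemingDivisorsLift R) : LocallyPrincipalIdealRing R :=
  fun p _ => (h.localization p.primeCompl).isPrincipalIdealRing_of_isLocalRing

end SeemingDivisorsLift

/-! ### Uniformizers at a prime -/

/-- Up to elements outside the prime `p`, every element of `R` vanishes or is a power of `π`. -/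
structure IsUniformizerAt {R : Type*} [CommRing R] (p : Ideal R) (π : R) : Prop where
  mem : π ∈ p
  zero_or_pow : ∀ a, (∃ t ∉ p, t * a = 0) ∨ ∃ k : ℕ, ∃ t ∉ p, ∃ t' ∉ p, t * a = t' * π ^ k

section Uniformizer

variable {R : Type u} [CommRing R]

theorem exists_isUniformizerAt (p : Ideal R) [p.IsPrime]
    [IsPrincipalIdealRing (Localization.AtPrime p)] : ∃ π, IsUniformizerAt p π := by
  obtain ⟨ϖ, hm, hϖ⟩ := IsLocalRing.exists_associated_pow (Localization.AtPrime p)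
  obtain ⟨π, s, rfl⟩ := IsLocalization.exists_mk'_eq p.primeCompl ϖ
  have hπϖ : Associated (IsLocalization.mk' (Localization.AtPrime p) π s)
      (algebraMap R (Localization.AtPrime p) π) := by
    obtain ⟨v, hv⟩ := IsLocalization.map_units (Localization.AtPrime p) s
    exact ⟨v, by rw [hv, IsLocalization.mk'_spec]⟩
  refine ⟨π, ?_, fun a => ?_⟩
  · rw [← IsLocalization.AtPrime.to_map_mem_maximal_iff (Localization.AtPrime p) p, hm]
    exact Ideal.mem_span_singleton.2 hπϖ.dvd
  · by_cases ha : algebraMap R (Localization.AtPrime p) a = 0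
    · obtain ⟨t, ht⟩ := (IsLocalization.map_eq_zero_iff p.primeCompl _ a).1 ha
      exact Or.inl ⟨t, t.2, ht⟩
    · obtain ⟨k, hk⟩ := hϖ _ ha
      obtain ⟨v, hv⟩ := hk.trans (hπϖ.pow_pow (n := k))
      obtain ⟨b, c, hbc⟩ := IsLocalization.exists_mk'_eq p.primeCompl (v : Localization.AtPrime p)
      have hb : b ∉ p := fun hb => by
        have := v.isUnit
        rw [← hbc] at this
        exact (IsLocalization.AtPrime.isUnit_mk'_iff (Localization.AtPrime p) p b c).1 this hb
      have h1 : algebraMap R (Localization.AtPrime p) (a * b) =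
          algebraMap R (Localization.AtPrime p) (π ^ k * c) := by
        rw [map_mul, map_mul, map_pow, ← hv, ← hbc, mul_assoc, IsLocalization.mk'_spec]
      obtain ⟨d, hd⟩ := (IsLocalization.eq_iff_exists p.primeCompl _).1 h1
      exact Or.inr ⟨k, d * b, p.primeCompl.mul_mem d.2 hb, d * c,
        p.primeCompl.mul_mem d.2 c.2, by linear_combination hd⟩

namespace IsUniformizerAt

variable {p q : Ideal R} {π : R}

theorem dvd_total [hp : p.IsPrime] (h : IsUniformizerAt p π) (a b : R) :
    ∃ t ∉ p, a ∣ t * b ∨ b ∣ t * a := by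
  rcases h.zero_or_pow a with ⟨t, ht, hta⟩ | ⟨k, t, ht, t', ht', hta⟩
  · exact ⟨t, ht, Or.inr (hta ▸ dvd_zero b)⟩
  rcases h.zero_or_pow b with ⟨s, hs, hsb⟩ | ⟨l, s, hs, s', hs', hsb⟩
  · exact ⟨s, hs, Or.inl (hsb ▸ dvd_zero a)⟩
  rcases le_total k l with hkl | hkl
  · obtain ⟨d, rfl⟩ := Nat.exists_eq_add_of_le hkl
    refine ⟨t' * s, p.primeCompl.mul_mem ht' hs, Or.inl ⟨t * s' * π ^ d, ?_⟩⟩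
    linear_combination t' * hsb - s' * π ^ d * hta
  · obtain ⟨d, rfl⟩ := Nat.exists_eq_add_of_le hkl
    refine ⟨s' * t, p.primeCompl.mul_mem hs' ht, Or.inr ⟨s * t' * π ^ d, ?_⟩⟩
    linear_combination s' * hta - t' * π ^ d * hsb

theorem exists_dvd_mul (h : IsUniformizerAt p π) {a : R} (ha : a ∈ p) :
    ∃ t ∉ p, π ∣ t * a := by
  rcases h.zero_or_pow a with ⟨t, ht, hta⟩ | ⟨_ | k, t, ht, t', ht', hta⟩
  · exact ⟨t, ht, hta ▸ dvd_zero π⟩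
  · rw [pow_zero, mul_one] at hta
    exact absurd (hta ▸ p.mul_mem_left t ha) ht'
  · exact ⟨t, ht, hta ▸ (dvd_pow_self π k.succ_ne_zero).mul_left t'⟩

theorem pow_of_not_mem [hq : q.IsPrime] (h : IsUniformizerAt p π) (hqp : q ≤ p)
    {x : R} (hx : x ∉ q) : ∃ k : ℕ, ∃ t ∉ p, x ∣ t * π ^ k := by
  rcases h.zero_or_pow x with ⟨t, ht, hta⟩ | ⟨k, t, ht, t', ht', hta⟩
  · rcases hq.mem_or_mem (hta ▸ q.zero_mem : t * x ∈ q) with h1 | h1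
    exacts [absurd (hqp h1) ht, absurd h1 hx]
  · exact ⟨k, t', ht', hta ▸ dvd_mul_left x t⟩

theorem not_mem_of_lt [p.IsPrime] [hq : q.IsPrime] (h : IsUniformizerAt p π) (hqp : q < p) :
    π ∉ q := fun hπ => by
  obtain ⟨a, hap, haq⟩ := SetLike.exists_of_lt hqp
  obtain ⟨t, ht, hta⟩ := h.exists_dvd_mul hap
  exact (hq.mem_or_mem (q.mem_of_dvd hta hπ)).elim (fun h1 => ht (hqp.le h1)) haq

end IsUniformizerAt

namespace LocallyPrincipalIdealRing

variable {p q : Ideal R}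

theorem exists_uniformizer (hR : LocallyPrincipalIdealRing R) (p : Ideal R) [p.IsPrime] : ∃ π, IsUniformizerAt p π :=
  have := hR p
  exists_isUniformizerAt p

/-- At a maximal ideal strictly above `p`, the uniformizer avoids `p`, although an element of `p`
outside `q` divides one of its powers locally. -/
theorem isMaximal_of_lt (hR : LocallyPrincipalIdealRing R) [hp : p.IsPrime] [hq : q.IsPrime]
    (hqp : q < p) : p.IsMaximal := by
  obtain ⟨m, hm, hpm⟩ := p.exists_le_maximal hp.ne_top
  rcases hpm.eq_or_lt with rfl | hlt
  · exact hm
  · have := hm.isPrime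
    obtain ⟨π, hπ⟩ := hR.exists_uniformizer m
    obtain ⟨a, hap, haq⟩ := SetLike.exists_of_lt hqp
    obtain ⟨k, t, ht, hta⟩ := hπ.pow_of_not_mem (hqp.le.trans hpm) haq
    rcases hp.mem_or_mem (p.mem_of_dvd hta hap) with h1 | h1
    · exact absurd (hpm h1) ht
    · exact absurd (hp.mem_of_pow_mem _ h1) (hπ.not_mem_of_lt hlt)

end LocallyPrincipalIdealRing

theorem exists_nilpotent_of_not_isReduced {p : Ideal R} [hp : p.IsPrime]
    (h : ¬ IsReduced (Localization.AtPrime p)) :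
    ∃ a, (∃ n : ℕ, ∃ t ∉ p, t * a ^ n = 0) ∧ ∀ t ∉ p, t * a ≠ 0 := by
  obtain ⟨x, hx, hx0⟩ : ∃ x : Localization.AtPrime p, IsNilpotent x ∧ x ≠ 0 := by
    by_contra! hall
    exact h ⟨hall⟩
  obtain ⟨a, s, rfl⟩ := IsLocalization.exists_mk'_eq p.primeCompl x
  have ha : algebraMap R (Localization.AtPrime p) a =
      IsLocalization.mk' (Localization.AtPrime p) a s * algebraMap R _ s :=
    (IsLocalization.mk'_spec _ _ _).symm
  refine ⟨a, ?_, fun t ht hta => hx0 ?_⟩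
  · obtain ⟨n, hn⟩ := hx
    have : algebraMap R (Localization.AtPrime p) (a ^ n) = 0 := by
      rw [map_pow, ha, mul_pow, hn, zero_mul]
    obtain ⟨t, ht⟩ := (IsLocalization.map_eq_zero_iff p.primeCompl _ _).1 this
    exact ⟨n, t, t.2, ht⟩
  · have : algebraMap R (Localization.AtPrime p) a = 0 :=
      (IsLocalization.map_eq_zero_iff p.primeCompl _ _).2 ⟨⟨t, ht⟩, hta⟩
    rw [ha] at this
    exact ((IsLocalization.map_units (Localization.AtPrime p) s).mul_left_eq_zero).1 this

namespace LocallyPrincipalIdealRing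

variable {p : Ideal R} [hp : p.IsPrime]

theorem isMaximal_of_not_isReduced (hR : LocallyPrincipalIdealRing R)
    (h : ¬ IsReduced (Localization.AtPrime p)) : p.IsMaximal := by
  obtain ⟨m, hm, hpm⟩ := p.exists_le_maximal hp.ne_top
  rcases hpm.eq_or_lt with rfl | hlt
  · exact hm
  · have := hm.isPrime
    obtain ⟨π, hπ⟩ := hR.exists_uniformizer m
    obtain ⟨a, ⟨n, t, ht, hta⟩, ha⟩ := exists_nilpotent_of_not_isReduced h
    have hap : a ∈ p := ((hp.mem_or_mem (hta ▸ p.zero_mem)).resolve_left ht) |> hp.mem_of_pow_mem n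
    rcases hπ.zero_or_pow a with ⟨t, ht, hta⟩ | ⟨k, s, hs, s', hs', hsa⟩
    · exact absurd hta (ha t fun h1 => ht (hpm h1))
    · rcases hp.mem_or_mem (hsa ▸ p.mul_mem_left s hap) with h1 | h1
      · exact absurd (hpm h1) hs'
      · exact absurd (hp.mem_of_pow_mem k h1) (hπ.not_mem_of_lt hlt)

end LocallyPrincipalIdealRing

namespace IsUniformizerAt

variable {p : Ideal R} [hp : p.IsPrime] {π : R}

theorem exists_mul_pow_eq_zero (hπ : IsUniformizerAt p π)
    (h : ¬ IsReduced (Localization.AtPrime p)) : ∃ n : ℕ, ∃ t ∉ p, t * π ^ n = 0 := by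
  obtain ⟨a, ⟨n, t, ht, hta⟩, ha⟩ := exists_nilpotent_of_not_isReduced h
  rcases hπ.zero_or_pow a with ⟨t, ht, hta⟩ | ⟨k, s, hs, s', hs', hsa⟩
  · exact absurd hta (ha t ht)
  · refine ⟨k * n, s' ^ n * t, p.primeCompl.mul_mem (p.primeCompl.pow_mem hs' n) ht, ?_⟩
    calc s' ^ n * t * π ^ (k * n) = (s' * π ^ k) ^ n * t := by rw [mul_pow, ← pow_mul]; ring
      _ = 0 := by rw [← hsa, mul_pow]; linear_combination s ^ n * hta

theorem mul_ne_zero_of_not_isReduced (hπ : IsUniformizerAt p π)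
    (h : ¬ IsReduced (Localization.AtPrime p)) {t : R} (ht : t ∉ p) : t * π ≠ 0 := fun h0 => by
  obtain ⟨a, ⟨n, t', ht', hta⟩, ha⟩ := exists_nilpotent_of_not_isReduced h
  have hap : a ∈ p := ((hp.mem_or_mem (hta ▸ p.zero_mem)).resolve_left ht') |> hp.mem_of_pow_mem n
  obtain ⟨s, hs, c, hc⟩ := hπ.exists_dvd_mul hap
  exact ha (t * s) (p.primeCompl.mul_mem ht hs) (by linear_combination t * hc + c * h0)

end IsUniformizerAt

/-! ### Topology of the spectrum from divisibility -/

namespace SeemingDivisorsLift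

theorem nonReducedPointsIsolated (h : SeemingDivisorsLift R) : NonReducedPointsIsolated R := by
  intro p hred
  have hR := h.locallyPrincipalIdealRing
  have hmax := hR.isMaximal_of_not_isReduced hred
  obtain ⟨π, hπ⟩ := hR.exists_uniformizer p.asIdeal
  obtain ⟨n, t, ht, htn⟩ := hπ.exists_mul_pow_eq_zero hred
  have hker : ∀ y, y ∈ RingHom.ker (algebraMap R (Localization.AtPrime p.asIdeal)) ↔
      ∃ t ∉ p.asIdeal, t * y = 0 := fun y => by
    rw [RingHom.mem_ker, IsLocalization.map_eq_zero_iff p.asIdeal.primeCompl]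
    exact ⟨fun ⟨t, ht⟩ => ⟨t, t.2, ht⟩, fun ⟨t, ht, hty⟩ => ⟨⟨t, ht⟩, hty⟩⟩
  -- If `v` were in `p`, then `v - 1` would be a unit at `p` and `π` would vanish there, contrary to
  -- non-reducedness. For `a ∈ p` a power of `a` lies in the kernel, so on `D(v * t)` any prime
  -- containing `π` contains `a`.
  obtain ⟨v, hv, hvI⟩ := h.exists_mul_mem_span
    (RingHom.ker (algebraMap R (Localization.AtPrime p.asIdeal))) π
  simp only [hker] at hv hvI
  have hvp : v ∉ p.asIdeal := fun hvp => by
    obtain ⟨s, hs, hs0⟩ := hv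
    refine hπ.mul_ne_zero_of_not_isReduced hred (p.asIdeal.primeCompl.mul_mem hs ?_)
      ((mul_assoc _ _ _).trans hs0)
    intro h1
    exact p.2.one_notMem (by simpa using p.asIdeal.sub_mem hvp h1)
  have : ({p} : Set (PrimeSpectrum R)) = PrimeSpectrum.basicOpen (v * t) := by
    refine Set.eq_of_subset_of_subset
      (Set.singleton_subset_iff.2 (p.asIdeal.primeCompl.mul_mem hvp ht)) fun s hs => ?_
    have hvs : v ∉ s.asIdeal := fun h1 => hs (s.asIdeal.mul_mem_right t h1)
    have hts : t ∉ s.asIdeal := fun h1 => hs (s.asIdeal.mul_mem_left v h1)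
    have hπs : π ∈ s.asIdeal :=
      s.2.mem_of_pow_mem n ((s.2.mem_or_mem (htn ▸ zero_mem _)).resolve_left hts)
    refine (PrimeSpectrum.ext (hmax.eq_of_le s.2.ne_top fun a ha => ?_)).symm
    obtain ⟨r, hr, c, hc⟩ := hπ.exists_dvd_mul ha
    have han : π ∣ v * a ^ n := by
      refine hvI _ ⟨t * r ^ n, p.asIdeal.primeCompl.mul_mem ht
        (p.asIdeal.primeCompl.pow_mem hr n), ?_⟩
      rw [mul_assoc, ← mul_pow, hc, mul_pow]
      linear_combination c ^ n * htn
    exact s.2.mem_of_pow_mem n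
      ((s.2.mem_or_mem (s.asIdeal.mem_of_dvd han hπs)).resolve_left hvs)
  rw [this]
  exact PrimeSpectrum.isOpen_basicOpen

/-- Every prime is isolated relative to `V(x) ∩ V(ann x)`. -/
theorem exists_isolating (h : SeemingDivisorsLift R) (x : R) (p : PrimeSpectrum R) :
    ∃ t ∉ p.asIdeal, ∀ s : PrimeSpectrum R, x ∈ s.asIdeal → (∀ t, x * t = 0 → t ∈ s.asIdeal) →
      t ∉ s.asIdeal → s = p := by
  by_contra! hcon
  -- The constant sequence `a` excludes proper specializations to `p` inside the closed set. The
  -- sequence built after this shrinks neighbourhoods of `p` indefinitely if `p` is not isolated.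
  have hmax : ∀ s : PrimeSpectrum R, x ∈ s.asIdeal → (∀ t, x * t = 0 → t ∈ s.asIdeal) →
      s.asIdeal ≤ p.asIdeal → s = p := by
    intro s hxs has hsp
    refine PrimeSpectrum.ext (le_antisymm hsp fun a ha => ?_)
    by_contra has'
    obtain ⟨L, hL⟩ := h.exists_prod_eq (fun _ => a) x
    obtain ⟨c, d, t, ht, hLt⟩ := hL (L + 1)
    simp only [Finset.prod_const, Finset.card_range] at hLt
    have h1 : a ^ L * (1 - a * c) ∈ s.asIdeal := by
      have : a ^ L * (1 - a * c) = x * d + t := by linear_combination hLt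
      rw [this]
      exact add_mem (s.asIdeal.mul_mem_right d hxs) (has t ht)
    have h2 := (s.2.mem_or_mem h1).resolve_left fun h3 => has' (s.2.mem_of_pow_mem L h3)
    exact p.2.one_notMem (by simpa using add_mem (hsp h2) (p.asIdeal.mul_mem_right c ha))
  have hstep : ∀ t : p.asIdeal.primeCompl, ∃ a : p.asIdeal.primeCompl, ∃ s : PrimeSpectrum R,
      x ∈ s.asIdeal ∧ (∀ t, x * t = 0 → t ∈ s.asIdeal) ∧ (t : R) ∉ s.asIdeal ∧
        (a : R) ∈ s.asIdeal := by
    intro t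
    obtain ⟨s, hxs, has, hts, hne⟩ := hcon t t.2
    obtain ⟨a, ha, hap⟩ := SetLike.not_le_iff_exists.1 fun hle => hne (hmax s hxs has hle)
    exact ⟨⟨a, hap⟩, s, hxs, has, hts, ha⟩
  choose a s hxs has hts hss using hstep
  let C : ℕ → p.asIdeal.primeCompl := fun n => Nat.rec 1 (fun _ t => t * a t) n
  have hC : ∀ n, ∏ i ∈ Finset.range n, (a (C i)).1 = (C n).1 := fun n => by
    induction n with
    | zero => simp [C]
    | succ n ih => rw [Finset.prod_range_succ, ih]; rfl
  obtain ⟨L, hL⟩ := h.exists_prod_eq (fun n => (a (C n)).1) x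
  obtain ⟨c, d, t, ht, hLt⟩ := hL (L + 1)
  rw [Finset.prod_range_succ, hC] at hLt
  refine hts (C L) (hLt ▸ add_mem (add_mem ?_ ?_) (has (C L) t ht))
  · exact Ideal.mul_mem_right _ _ (Ideal.mul_mem_left _ _ (hss (C L)))
  · exact Ideal.mul_mem_right _ _ (hxs (C L))

/-- Otherwise some `x ∉ q` vanishes on `S`, so `ann x ⊆ q ⊆ p`. The cyclic test with `I = ann x` and
`r = x` gives `v ∉ p` with `x ∣ v * a` for every `a ∈ ann x`, so points of `S` in `D(v)` lie in
`V(x) ∩ V(ann x)`, where `p` is isolated. -/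
theorem accumulationPassesDown (h : SeemingDivisorsLift R) : AccumulationPassesDown R := by
  intro p q S hpS hacc hqp U hU hqU
  by_contra hempty
  obtain ⟨_, ⟨x, rfl⟩, hxq, hxU⟩ :=
    PrimeSpectrum.isTopologicalBasis_basic_opens.exists_subset_of_mem_open hqU hU
  have hxS : ∀ s ∈ S, x ∈ s.asIdeal := fun s hs => by
    by_contra hxs
    exact hempty ⟨s, hxU hxs, hs⟩
  have hxp : x ∈ p.asIdeal := by
    by_contra hxp
    obtain ⟨s, hs, hsS⟩ := hacc _ (PrimeSpectrum.isOpen_basicOpen (a := x)) hxp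
    exact hs (hxS s hsS)
  have hann : ∀ t, x * t = 0 → t ∈ q.asIdeal := fun t ht =>
    (q.2.mem_or_mem (ht ▸ zero_mem _)).resolve_left hxq
  obtain ⟨t, ht, hiso⟩ := h.exists_isolating x p
  obtain ⟨v, hv, hvI⟩ := h.exists_mul_mem_span (LinearMap.ker (LinearMap.mulLeft R x)) x
  simp only [LinearMap.mem_ker, LinearMap.mulLeft_apply] at hv hvI
  have hvp : v ∉ p.asIdeal := fun hvp => by
    have := (q.2.mem_or_mem (hann _ hv)).resolve_right hxq
    exact p.2.one_notMem (by simpa using sub_mem hvp (hqp this))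
  obtain ⟨s, hs, hsS⟩ := hacc _ (PrimeSpectrum.isOpen_basicOpen (a := v * t))
    (p.asIdeal.primeCompl.mul_mem hvp ht)
  have hvs : v ∉ s.asIdeal := fun h1 => hs (s.asIdeal.mul_mem_right t h1)
  have hts : t ∉ s.asIdeal := fun h1 => hs (s.asIdeal.mul_mem_left v h1)
  refine hpS (hiso s (hxS s hsS) (fun a ha => ?_) hts ▸ hsS)
  exact (s.2.mem_or_mem (s.asIdeal.mem_of_dvd (hvI a ha) (hxS s hsS))).resolve_left hvs

end SeemingDivisorsLift

end Uniformizer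

/-! ### Splitting of pure submodules -/

/-- Nonzero modules killed by `J` contain nonzero elements
with principal annihilator modulo `J` that generate a pure submodule. -/
def HasPureCyclicSubmodules {R : Type*} [CommRing R] (J : Ideal R) : Prop :=
  ∀ (X : Type v) [AddCommGroup X] [Module R X] [Nontrivial X], (∀ j ∈ J, ∀ y : X, j • y = 0) →
    ∃ x : X, x ≠ 0 ∧ (∃ s : R, s • x = 0 ∧ ∀ a : R, a • x = 0 → ∃ c, a - c * s ∈ J) ∧
      ∀ (s a : R) (y : X), s • y = a • x → ∃ a' : R, a • x = s • a' • x

section Pure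

variable {R : Type*} [CommRing R] {P : Type v} [AddCommGroup P] [Module R P]

theorem exists_maximal_pure_complement (B C₀ : Submodule R P) (hd : Disjoint B C₀)
    (hpure : ∀ (s : R) (y : P), s • y ∈ B ⊔ C₀ → ∃ b ∈ B, s • y - s • b ∈ C₀) :
    ∃ C, C₀ ≤ C ∧ Maximal (fun C => Disjoint B C ∧
      ∀ (s : R) (y : P), s • y ∈ B ⊔ C → ∃ b ∈ B, s • y - s • b ∈ C) C := by
  refine zorn_le_nonempty₀ {C | Disjoint B C ∧
      ∀ (s : R) (y : P), s • y ∈ B ⊔ C → ∃ b ∈ B, s • y - s • b ∈ C}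
    (fun c hc hchain D hD => ⟨sSup c, ⟨?_, ?_⟩, fun z hz => le_sSup hz⟩) C₀ ⟨hd, hpure⟩
  · rw [Submodule.disjoint_def]
    intro x hxB hx
    obtain ⟨C, hC, hxC⟩ := (Submodule.mem_sSup_of_directed ⟨D, hD⟩ hchain.directedOn).1 hx
    exact Submodule.disjoint_def.1 (hc hC).1 x hxB hxC
  · intro s y hy
    obtain ⟨b, hb, z, hz, hbz⟩ := Submodule.mem_sup.1 hy
    obtain ⟨C, hC, hzC⟩ := (Submodule.mem_sSup_of_directed ⟨D, hD⟩ hchain.directedOn).1 hz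
    obtain ⟨b', hb', h⟩ := (hc hC).2 s y (Submodule.mem_sup.2 ⟨b, hb, z, hzC, hbz⟩)
    exact ⟨b', hb', le_sSup hC h⟩

/-- A submodule killed by `J` that is pure modulo `C₀ ⊇ J • P` is a direct summand. -/
theorem exists_isCompl_of_pure {J : Ideal R} (hJ : HasPureCyclicSubmodules.{v} J)
    (B C₀ : Submodule R P) (hd : Disjoint B C₀) (hJC : ∀ j ∈ J, ∀ y : P, j • y ∈ C₀)
    (hpure : ∀ (s : R) (y : P), s • y ∈ B ⊔ C₀ → ∃ b ∈ B, s • y - s • b ∈ C₀) :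
    ∃ C, C₀ ≤ C ∧ IsCompl B C := by
  obtain ⟨C, hC₀, ⟨hdC, hC⟩, hmax⟩ := exists_maximal_pure_complement B C₀ hd hpure
  refine ⟨C, hC₀, hdC, codisjoint_iff.2 ?_⟩
  by_contra hne
  have : Nontrivial (P ⧸ (B ⊔ C)) := Submodule.Quotient.nontrivial_iff.2 hne
  obtain ⟨x, hx, ⟨s, hsx, hs⟩, hxp⟩ := hJ (P ⧸ (B ⊔ C)) fun j hj y => by
    obtain ⟨y, rfl⟩ := Submodule.Quotient.mk_surjective _ y
    rw [← Submodule.Quotient.mk_smul, Submodule.Quotient.mk_eq_zero]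
    exact (le_sup_right : C ≤ B ⊔ C) (hC₀ (hJC j hj y))
  obtain ⟨x, rfl⟩ := Submodule.Quotient.mk_surjective _ x
  rw [← Submodule.Quotient.mk_smul, Submodule.Quotient.mk_eq_zero] at hsx
  -- Since the annihilator of the class of `x` is generated by `s` modulo `J`, one correction by
  -- `b₀` moves all its multiples of `x` from `B ⊔ C` into `C`. Adjoining the corrected element
  -- therefore keeps `C` disjoint from `B`, and purity of the cyclic submodule preserves the other
  -- condition.
  obtain ⟨b₀, hb₀, hsb⟩ := hC s x hsx
  have hmk : (Submodule.Quotient.mk (x - b₀) : P ⧸ (B ⊔ C)) = Submodule.Quotient.mk x := by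
    rw [Submodule.Quotient.eq]
    have : x - b₀ - x = -b₀ := by abel
    rw [this]
    exact neg_mem ((le_sup_left : B ≤ B ⊔ C) hb₀)
  rw [← smul_sub] at hsb
  rw [← hmk] at hx hs hxp
  set x' := x - b₀
  have hann : ∀ a : R, a • x' ∈ B ⊔ C → a • x' ∈ C := fun a ha => by
    obtain ⟨c, hc⟩ := hs a (by rwa [← Submodule.Quotient.mk_smul, Submodule.Quotient.mk_eq_zero])
    have : a • x' = (a - c * s) • x' + c • s • x' := by rw [sub_smul, mul_smul]; abel
    rw [this]
    exact add_mem (hC₀ (hJC _ hc _)) (C.smul_mem c hsb)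
  have hle : C ⊔ Submodule.span R {x'} ≤ C := by
    refine hmax ⟨?_, fun t y hy => ?_⟩ le_sup_left
    · rw [Submodule.disjoint_def]
      intro b hb hb'
      obtain ⟨c, hc, z, hz, rfl⟩ := Submodule.mem_sup.1 hb'
      obtain ⟨a, rfl⟩ := Submodule.mem_span_singleton.1 hz
      refine Submodule.disjoint_def.1 hdC _ hb (add_mem hc (hann a ?_))
      exact Submodule.mem_sup.2 ⟨_, hb, -c, neg_mem hc, by abel⟩
    · rw [← sup_assoc] at hy
      obtain ⟨w, hw, z, hz, hwz⟩ := Submodule.mem_sup.1 hy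
      obtain ⟨a, rfl⟩ := Submodule.mem_span_singleton.1 hz
      obtain ⟨a', ha'⟩ := hxp t a (Submodule.Quotient.mk y) (by
        rw [← Submodule.Quotient.mk_smul, ← Submodule.Quotient.mk_smul, Submodule.Quotient.eq,
          ← hwz, add_sub_cancel_right]
        exact hw)
      rw [← Submodule.Quotient.mk_smul, ← Submodule.Quotient.mk_smul,
        ← Submodule.Quotient.mk_smul, Submodule.Quotient.eq] at ha'
      obtain ⟨b, hb, h⟩ := hC t (y - a' • x') (by
        have : t • (y - a' • x') = w + (a • x' - t • a' • x') := by rw [smul_sub, ← hwz]; abel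
        rw [this]
        exact add_mem hw ha')
      refine ⟨b, hb, ?_⟩
      have : t • y - t • b = (t • (y - a' • x') - t • b) + (t * a') • x' := by
        rw [smul_sub, mul_smul]; abel
      rw [this]
      exact add_mem ((le_sup_left : C ≤ _) h) ((le_sup_right : _ ≤ C ⊔ Submodule.span R {x'})
        (Submodule.smul_mem _ _ (Submodule.mem_span_singleton_self x')))
  refine hx ((Submodule.Quotient.mk_eq_zero _).2 ?_)
  exact (le_sup_right : C ≤ B ⊔ C) (hle ((le_sup_right : _ ≤ C ⊔ Submodule.span R {x'})
    (Submodule.mem_span_singleton_self x')))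

end Pure

/-! ### Modules over rings with discrete spectrum -/

section Isolated

variable {A : Type*} [CommRing A] {p : PrimeSpectrum A} {ε π : A}

theorem exists_mul_eq_of_basicOpen_eq_singleton (hε : IsIdempotentElem ε)
    (hp : ({p} : Set (PrimeSpectrum A)) = PrimeSpectrum.basicOpen ε) {t : A} (ht : t ∉ p.asIdeal) :
    ∃ c, ε * (t * c) = ε := by
  have htop : Ideal.span {t, 1 - ε} = ⊤ := by
    by_contra hne
    obtain ⟨m, hm, hle⟩ := Ideal.exists_le_maximal _ hne
    have hεm : ε ∉ m := fun h => hm.isPrime.one_notMem (by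
      simpa using add_mem h (hle (Ideal.subset_span (by simp : (1 - ε) ∈ ({t, 1 - ε} : Set A)))))
    have : (⟨m, hm.isPrime⟩ : PrimeSpectrum A) ∈ ({p} : Set _) := hp ▸ hεm
    rw [Set.mem_singleton_iff] at this
    exact ht (this ▸ hle (Ideal.subset_span (by simp)))
  obtain ⟨a, b, hab⟩ := Ideal.mem_span_pair.1 (htop ▸ Submodule.mem_top : (1 : A) ∈ _)
  exact ⟨a, by linear_combination ε * hab + b * hε.eq⟩

theorem exists_mul_pow_eq_zero_of_basicOpen_eq_singleton
    (hp : ({p} : Set (PrimeSpectrum A)) = PrimeSpectrum.basicOpen ε) (hπ : π ∈ p.asIdeal)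
    (hε : IsIdempotentElem ε) : ∃ n : ℕ, ε * π ^ n = 0 := by
  have : IsNilpotent (ε * π) := by
    refine nilpotent_iff_mem_prime.2 fun s hs => ?_
    by_cases hεs : ε ∈ s
    · exact s.mul_mem_right _ hεs
    · have : (⟨s, hs⟩ : PrimeSpectrum A) ∈ ({p} : Set _) := hp ▸ hεs
      rw [Set.mem_singleton_iff] at this
      subst this
      exact s.mul_mem_left _ hπ
  obtain ⟨n, hn⟩ := this
  refine ⟨n, ?_⟩
  rcases n with _ | n
  · rw [pow_zero] at hn ⊢
    rw [← mul_one (ε * 1), hn, mul_zero]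
  · rwa [mul_pow, hε.pow_succ_eq] at hn

theorem IsUniformizerAt.exists_eq_pow (h : IsUniformizerAt p.asIdeal π)
    (hε : IsIdempotentElem ε) (hp : ({p} : Set (PrimeSpectrum A)) = PrimeSpectrum.basicOpen ε)
    (a : A) : ∃ (k : ℕ) (c c' : A), ε * a = ε * c * π ^ k ∧ ε * π ^ k = ε * c' * a := by
  rcases h.zero_or_pow a with ⟨t, ht, hta⟩ | ⟨k, t, ht, t', ht', hta⟩
  · obtain ⟨n, hn⟩ := exists_mul_pow_eq_zero_of_basicOpen_eq_singleton hp h.mem hε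
    obtain ⟨c, hc⟩ := exists_mul_eq_of_basicOpen_eq_singleton hε hp ht
    exact ⟨n, 0, 0, by linear_combination ε * c * hta - a * hc, by linear_combination hn⟩
  · obtain ⟨c, hc⟩ := exists_mul_eq_of_basicOpen_eq_singleton hε hp ht
    obtain ⟨c', hc'⟩ := exists_mul_eq_of_basicOpen_eq_singleton hε hp ht'
    exact ⟨k, c * t', c' * t, by linear_combination ε * c * hta - a * hc,
      by linear_combination -ε * c' * hta - π ^ k * hc'⟩

theorem exists_idempotent_basicOpen_eq_singleton [DiscreteTopology (PrimeSpectrum A)]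
    (p : PrimeSpectrum A) :
    ∃ ε : A, IsIdempotentElem ε ∧ ({p} : Set (PrimeSpectrum A)) = PrimeSpectrum.basicOpen ε :=
  PrimeSpectrum.exists_idempotent_basicOpen_eq_of_isClopen (isClopen_discrete _)

/-- An isolated point supporting an element of `X` gives a component `ε • X` killed by a power of
the uniformizer. As over a discrete valuation ring, an element of maximal order generates a pure
submodule. -/
theorem exists_pure_cyclic_submodule [DiscreteTopology (PrimeSpectrum A)]
    (hA : ∀ p : PrimeSpectrum A, ∃ π, IsUniformizerAt p.asIdeal π)
    (X : Type*) [AddCommGroup X] [Module A X] [Nontrivial X] :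
    ∃ x : X, x ≠ 0 ∧ (∃ s : A, s • x = 0 ∧ ∀ a : A, a • x = 0 → s ∣ a) ∧
      ∀ (s a : A) (y : X), s • y = a • x → ∃ a' : A, a • x = s • a' • x := by
  classical
  obtain ⟨x₀, hx₀⟩ := exists_ne (0 : X)
  obtain ⟨m, hm, hle⟩ := Ideal.exists_le_maximal (LinearMap.ker (LinearMap.toSpanSingleton A X x₀))
    (fun h => hx₀ (by simpa using (h ▸ Submodule.mem_top :
      (1 : A) ∈ LinearMap.ker (LinearMap.toSpanSingleton A X x₀))))
  let p : PrimeSpectrum A := ⟨m, hm.isPrime⟩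
  obtain ⟨ε, hε, hp⟩ := exists_idempotent_basicOpen_eq_singleton p
  obtain ⟨π, hπ⟩ := hA p
  have hεp : ε ∉ m := (hp ▸ Set.mem_singleton p : p ∈ (PrimeSpectrum.basicOpen ε : Set _))
  have hex : ∃ n : ℕ, ∀ y : X, (ε * π ^ n) • y = 0 := by
    obtain ⟨n, hn⟩ := exists_mul_pow_eq_zero_of_basicOpen_eq_singleton hp hπ.mem hε
    exact ⟨n, fun y => by rw [hn, zero_smul]⟩
  obtain ⟨n, hn⟩ : ∃ n, Nat.find hex = n + 1 := Nat.exists_eq_succ_of_ne_zero fun h0 => by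
    have := Nat.find_spec hex x₀
    rw [h0, pow_zero, mul_one] at this
    exact hεp (hle (by simpa using this))
  have hzero : ∀ k, n < k → ∀ y : X, (ε * π ^ k) • y = 0 := fun k hk y => by
    obtain ⟨d, rfl⟩ := Nat.exists_eq_add_of_le (hn ▸ hk : Nat.find hex ≤ k)
    rw [pow_add, ← mul_assoc, mul_comm, mul_smul, Nat.find_spec hex y, smul_zero]
  obtain ⟨y₀, hy₀⟩ : ∃ y : X, (ε * π ^ n) • y ≠ 0 := by
    have := Nat.find_min hex (m := n) (by lia)
    push Not at this
    exact this
  have hεx : ∀ a : A, a • ε • y₀ = (ε * a) • ε • y₀ := fun a => by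
    rw [smul_smul, smul_smul]
    congr 1
    linear_combination -a * hε.eq
  have hk : ∀ (a : A) (k : ℕ) (c' : A), ε * π ^ k = ε * c' * a → a • ε • y₀ = 0 → n < k := by
    intro a k c' hc' ha
    by_contra! hkn
    obtain ⟨d, rfl⟩ := Nat.exists_eq_add_of_le hkn
    refine hy₀ ?_
    have : ε * π ^ (k + d) = π ^ d * c' * a * ε := by
      rw [pow_add]; linear_combination π ^ d * hc'
    rw [this, mul_smul, mul_smul, ha, smul_zero]
  -- The annihilator is everything off the component and `π ^ (n + 1)` on it.
  refine ⟨ε • y₀, fun h0 => hy₀ ?_, ⟨1 - ε + ε * π ^ (n + 1), ?_, fun a ha => ?_⟩,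
    fun s a y hsa => ?_⟩
  · rw [mul_comm, mul_smul, h0, smul_zero]
  · rw [add_smul, hzero _ n.lt_succ_self, add_zero, smul_smul, sub_mul, one_mul, hε.eq, sub_self,
      zero_smul]
  · obtain ⟨k, c, c', hc, hc'⟩ := hπ.exists_eq_pow hε hp a
    obtain ⟨d, rfl⟩ := Nat.exists_eq_add_of_lt (hk a k c' hc' ha)
    refine ⟨(1 - ε) * a + ε * c * π ^ d, ?_⟩
    linear_combination hc +
      (c * π ^ d - a + π ^ (n + 1) * a - c * π ^ (n + 1) * π ^ d) * hε.eq
  · obtain ⟨i, c₁, c₁', h1, h1'⟩ := hπ.exists_eq_pow hε hp s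
    obtain ⟨d, c₂, c₂', h2, h2'⟩ := hπ.exists_eq_pow hε hp a
    rcases le_or_gt i d with hid | hid
    · obtain ⟨l, rfl⟩ := Nat.exists_eq_add_of_le hid
      refine ⟨c₂ * π ^ l * c₁', ?_⟩
      rw [hεx a, h2, smul_smul s, hεx (s * _)]
      congr 1
      rw [pow_add]
      linear_combination c₂ * π ^ l * h1'
    · by_cases hax : a • ε • y₀ = 0
      · exact ⟨0, by rw [hax, zero_smul, smul_zero]⟩
      -- Here `s` has order `i > d`. Multiplying `s • y = a • x` by `π ^ (n - d)` would make `π ^ n`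
      -- kill the chosen element, as `π ^ (n + 1)` kills the component.
      · exfalso
        have hdn : d ≤ n := by
          by_contra! hnd
          refine hax ?_
          rw [hεx a, h2, mul_right_comm, mul_smul, smul_comm, hzero d hnd, smul_zero]
        obtain ⟨l, rfl⟩ := Nat.exists_eq_add_of_le hdn
        have h3 : (ε * c₂' * π ^ l * a) • ε • y₀ = 0 := by
          rw [mul_smul, ← hsa, smul_smul]
          have : ε * c₂' * π ^ l * s = c₂' * c₁ * (ε * π ^ (l + i)) := by
            rw [pow_add]; linear_combination c₂' * π ^ l * h1
          rw [this, mul_smul, hzero _ (by lia), smul_zero]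
        refine hy₀ ?_
        rw [← h3, smul_smul]
        congr 1
        rw [pow_add]
        linear_combination π ^ l * h2' - (c₂' * π ^ l * a) * hε.eq

end Isolated

theorem IsUniformizerAt.map {R A : Type*} [CommRing R] [CommRing A] {f : R →+* A}
    (hf : Function.Surjective f) {p : Ideal A} {π : R} (h : IsUniformizerAt (p.comap f) π) :
    IsUniformizerAt p (f π) := by
  refine ⟨h.mem, fun a => ?_⟩
  obtain ⟨a, rfl⟩ := hf a
  rcases h.zero_or_pow a with ⟨t, ht, hta⟩ | ⟨k, t, ht, t', ht', hta⟩
  · exact Or.inl ⟨f t, ht, by rw [← map_mul, hta, map_zero]⟩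
  · exact Or.inr ⟨k, f t, ht, f t', ht', by rw [← map_mul, hta, map_mul, map_pow]⟩

theorem LocallyPrincipalIdealRing.exists_uniformizer_of_surjective {R : Type u} {A : Type*}
    [CommRing R] [CommRing A] (hR : LocallyPrincipalIdealRing R) {f : R →+* A}
    (hf : Function.Surjective f) (p : PrimeSpectrum A) : ∃ π, IsUniformizerAt p.asIdeal π := by
  obtain ⟨π, hπ⟩ := hR.exists_uniformizer (p.asIdeal.comap f)
  exact ⟨f π, hπ.map hf⟩

theorem LocallyPrincipalIdealRing.hasPureCyclicSubmodules {R : Type u} [CommRing R]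
    (hR : LocallyPrincipalIdealRing R) (J : Ideal R) [DiscreteTopology (PrimeSpectrum (R ⧸ J))] :
    HasPureCyclicSubmodules.{v} J := by
  intro X _ _ _ hX
  have hX' : Module.IsTorsionBySet R X J := fun y j => hX j j.2 y
  let _ : Module (R ⧸ J) X := hX'.module
  have hmk : ∀ (a : R) (y : X), Ideal.Quotient.mk J a • y = a • y := fun a y => rfl
  obtain ⟨x, hx, ⟨s, hsx, hs⟩, hxp⟩ := exists_pure_cyclic_submodule
    (hR.exists_uniformizer_of_surjective (Ideal.Quotient.mk_surjective (I := J))) X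
  obtain ⟨s, rfl⟩ := Ideal.Quotient.mk_surjective s
  refine ⟨x, hx, ⟨s, hsx, fun a ha => ?_⟩, fun t a y hta => ?_⟩
  · obtain ⟨c, hc⟩ := hs (Ideal.Quotient.mk J a) ha
    obtain ⟨c, rfl⟩ := Ideal.Quotient.mk_surjective c
    refine ⟨c, ?_⟩
    rw [mul_comm, ← Ideal.Quotient.eq, hc, map_mul]
  · obtain ⟨a', ha'⟩ := hxp (Ideal.Quotient.mk J t) (Ideal.Quotient.mk J a) y hta
    obtain ⟨a', rfl⟩ := Ideal.Quotient.mk_surjective a'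
    exact ⟨a', ha'⟩

theorem eq_top_of_forall_isMaximal_exists {R : Type*} [CommRing R] {I : Ideal R}
    (h : ∀ m : Ideal R, m.IsMaximal → ∃ t ∉ m, t ∈ I) : I = ⊤ := by
  by_contra hne
  obtain ⟨m, hm, hle⟩ := Ideal.exists_le_maximal _ hne
  obtain ⟨t, ht, htI⟩ := h m hm
  exact ht (hle htI)

theorem eq_zero_of_forall_prime_exists {R : Type*} [CommRing R] {a : R}
    (h : ∀ p : PrimeSpectrum R, ∃ t ∉ p.asIdeal, t * a = 0) : a = 0 := by
  have := eq_top_of_forall_isMaximal_exists (I := LinearMap.ker (LinearMap.mulRight R a))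
    fun m hm => h ⟨m, hm.isPrime⟩
  simpa using (this ▸ Submodule.mem_top : (1 : R) ∈ LinearMap.ker (LinearMap.mulRight R a))

/-! ### The locus where an element vanishes locally -/

section Splitting

variable {R : Type u} [CommRing R]

theorem isAccumulationPoint_iff_mem_closure {X : Type*} [TopologicalSpace X] {p : X} {S : Set X} :
    IsAccumulationPoint p S ↔ p ∈ closure S :=
  mem_closure_iff.symm

/-- An element that does not vanish in a reduced local ring of `R` avoids some smaller prime. -/
theorem exists_prime_le_not_mem {p : Ideal R} [hp : p.IsPrime] [IsReduced (Localization.AtPrime p)]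
    {x : R} (hx : ∀ t ∉ p, t * x ≠ 0) : ∃ q : PrimeSpectrum R, q.asIdeal ≤ p ∧ x ∉ q.asIdeal := by
  have hx0 : algebraMap R (Localization.AtPrime p) x ≠ 0 := fun h0 => by
    obtain ⟨t, ht⟩ := (IsLocalization.map_eq_zero_iff p.primeCompl _ _).1 h0
    exact hx t t.2 ht
  have hnil : ¬ IsNilpotent (algebraMap R (Localization.AtPrime p) x) := fun h => hx0 h.eq_zero
  rw [nilpotent_iff_mem_prime] at hnil
  push Not at hnil
  obtain ⟨Q, hQ, hxQ⟩ := hnil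
  refine ⟨⟨Q.comap (algebraMap R _), inferInstance⟩, fun a ha => ?_, hxQ⟩
  by_contra hap
  exact hQ.ne_top (Q.eq_top_of_isUnit_mem ha
    (IsLocalization.map_units (Localization.AtPrime p) (⟨a, hap⟩ : p.primeCompl)))

/-- The set of primes at which `x` vanishes locally. -/
def localZeros (x : R) : Set (PrimeSpectrum R) := {p | ∃ t ∉ p.asIdeal, t * x = 0}

theorem isOpen_localZeros (x : R) : IsOpen (localZeros x) := by
  rw [isOpen_iff_forall_mem_open]
  rintro p ⟨t, ht, htx⟩
  exact ⟨PrimeSpectrum.basicOpen t, fun s hs => ⟨t, hs, htx⟩, PrimeSpectrum.isOpen_basicOpen, ht⟩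

theorem localZeros_subset (x : R) : localZeros x ⊆ PrimeSpectrum.zeroLocus {x} := by
  rintro p ⟨t, ht, htx⟩
  exact Set.singleton_subset_iff.2 ((p.2.mem_or_mem (htx ▸ zero_mem _)).resolve_left ht)

/-- At a reduced point some smaller prime `q` avoids `x`; accumulation would pass down to `q`, which
is outside the closed set `V(x)`. A non-reduced point is isolated. This yields both that `localZeros
x` is closed and that the rest of `V(x)` is discrete. -/
theorem not_mem_closure_of_not_mem_localZeros
    (hred : NonReducedPointsIsolated R) (hacc : AccumulationPassesDown R) {x : R} {p : PrimeSpectrum R}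
    (hp : p ∉ localZeros x) {S : Set (PrimeSpectrum R)} (hpS : p ∉ S)
    (hS : S ⊆ PrimeSpectrum.zeroLocus {x}) : p ∉ closure S := by
  intro hcl
  by_cases hr : IsReduced (Localization.AtPrime p.asIdeal)
  · obtain ⟨q, hqp, hxq⟩ := exists_prime_le_not_mem (p := p.asIdeal) (x := x)
      fun t ht htx => hp ⟨t, ht, htx⟩
    have hq := isAccumulationPoint_iff_mem_closure.1
      (hacc p q S hpS (isAccumulationPoint_iff_mem_closure.2 hcl) hqp)
    have := closure_minimal hS (PrimeSpectrum.isClosed_zeroLocus _) hq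
    exact hxq (this rfl)
  · obtain ⟨s, hs, hsS⟩ := mem_closure_iff.1 hcl _ (hred p hr) rfl
    exact hpS (Set.mem_singleton_iff.1 hs ▸ hsS)

theorem isClosed_localZeros
    (hred : NonReducedPointsIsolated R) (hacc : AccumulationPassesDown R) (x : R) : IsClosed (localZeros x) := by
  refine isClosed_of_closure_subset fun p hp => ?_
  by_contra hpz
  exact not_mem_closure_of_not_mem_localZeros hred hacc hpz hpz (localZeros_subset x) hp

theorem exists_idempotent_localZeros
    (hred : NonReducedPointsIsolated R) (hacc : AccumulationPassesDown R) (x : R) :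
    ∃ e : R, IsIdempotentElem e ∧ e * x = 0 ∧
      localZeros x = PrimeSpectrum.basicOpen e := by
  obtain ⟨e, he, hex⟩ := PrimeSpectrum.exists_idempotent_basicOpen_eq_of_isClopen
    ⟨isClosed_localZeros hred hacc x, isOpen_localZeros x⟩
  refine ⟨e, he, eq_zero_of_forall_prime_exists fun p => ?_, hex⟩
  by_cases hp : p ∈ localZeros x
  · obtain ⟨t, ht, htx⟩ := hp
    exact ⟨t, ht, by linear_combination e * htx⟩
  · have hep : e ∈ p.asIdeal := by
      rw [hex] at hp
      exact not_not.1 hp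
    refine ⟨1 - e, fun h1 => p.2.one_notMem (by simpa using add_mem h1 hep), ?_⟩
    linear_combination -x * he.eq

theorem exists_isolating_of_not_mem_localZeros
    (hred : NonReducedPointsIsolated R) (hacc : AccumulationPassesDown R) {x : R} {p : PrimeSpectrum R}
    (hp : p ∉ localZeros x) : ∃ t ∉ p.asIdeal, ∀ s : PrimeSpectrum R, x ∈ s.asIdeal →
      t ∉ s.asIdeal → s = p := by
  have := not_mem_closure_of_not_mem_localZeros hred hacc hp
    (S := PrimeSpectrum.zeroLocus {x} \ {p}) (fun h => h.2 rfl) Set.sdiff_subset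
  rw [← Set.mem_compl_iff] at this
  obtain ⟨_, ⟨t, rfl⟩, ht, hts⟩ := PrimeSpectrum.isTopologicalBasis_basic_opens.exists_subset_of_mem_open
    this isClosed_closure.isOpen_compl
  refine ⟨t, ht, fun s hxs hs => ?_⟩
  by_contra hne
  exact hts hs (subset_closure ⟨Set.singleton_subset_iff.2 hxs, hne⟩)

end Splitting

theorem discreteTopology_of_isolating {R : Type*} [CommRing R] (J : Ideal R)
    (h : ∀ p : PrimeSpectrum R, J ≤ p.asIdeal → ∃ t ∉ p.asIdeal, ∀ s : PrimeSpectrum R,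
      J ≤ s.asIdeal → t ∉ s.asIdeal → s = p) : DiscreteTopology (PrimeSpectrum (R ⧸ J)) := by
  have hJ : ∀ p : PrimeSpectrum (R ⧸ J), J ≤ (p.comap (Ideal.Quotient.mk J)).asIdeal :=
    fun p a ha => by
      rw [PrimeSpectrum.comap_asIdeal, Ideal.mem_comap, Ideal.Quotient.eq_zero_iff_mem.2 ha]
      exact zero_mem _
  refine discreteTopology_iff_isOpen_singleton.2 fun p => ?_
  obtain ⟨t, ht, hiso⟩ := h _ (hJ p)
  have : ({p} : Set _) = PrimeSpectrum.basicOpen (Ideal.Quotient.mk J t) := by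
    refine Set.eq_of_subset_of_subset (Set.singleton_subset_iff.2 ht) fun s hs => ?_
    exact PrimeSpectrum.comap_injective_of_surjective _ Ideal.Quotient.mk_surjective
      (hiso _ (hJ s) hs)
  rw [this]
  exact PrimeSpectrum.isOpen_basicOpen

/-! ### Lifting through multiplication by an element -/

section Lift

variable {R : Type u} [CommRing R]

theorem exists_divisibleInHomBy {M N : Type v} [AddCommGroup M] [AddCommGroup N]
    [Module R M] [Module R N] (hR : LocallyPrincipalIdealRing R) {r e : R}
    (he : IsIdempotentElem e) (her : e * r = 0)
    [DiscreteTopology (PrimeSpectrum (R ⧸ Ideal.span {r, e}))]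
    {f : M →ₗ[R] N} (hf : SeeminglyDivisibleBy f r) : DivisibleInHomBy f r := by
  let P : Submodule R (M × N) := LinearMap.ker (f ∘ₗ LinearMap.fst R M N - r • LinearMap.snd R M N)
  have hP : ∀ y : M × N, y ∈ P ↔ f y.1 = r • y.2 := fun y => by
    simp [P, LinearMap.mem_ker, sub_eq_zero]
  let φ : P →ₗ[R] M := LinearMap.fst R M N ∘ₗ P.subtype
  let ψ : P →ₗ[R] N := LinearMap.snd R M N ∘ₗ P.subtype
  have hφψ : ∀ y : P, f (φ y) = r • ψ y := fun y => (hP y).1 y.2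
  have hext : ∀ y z : P, φ y = φ z → ψ y = ψ z → y = z := fun y z h1 h2 =>
    Subtype.ext (Prod.ext h1 h2)
  have hφ : Function.Surjective φ := fun m => by
    obtain ⟨n, hn⟩ := hf.2 m
    exact ⟨⟨(m, n), (hP _).2 hn⟩, rfl⟩
  have hkill : ∀ y : P, r • φ y = 0 → r • y = 0 := fun y hy => by
    refine hext _ _ (by rw [map_smul, hy, map_zero]) ?_
    rw [map_smul, ← hφψ, hf.1 _ hy, map_zero]
  -- `B` is the part of the `r`-torsion of `N` away from `e`. On the `e`-part `r` is zero, so no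
  -- correction is needed and `e • P` can go into `C₀`.
  let B : Submodule R P := LinearMap.ker φ ⊓ LinearMap.ker (e • ψ)
  let C₀ : Submodule R P := LinearMap.range (r • (LinearMap.id : P →ₗ[R] P)) ⊔
    LinearMap.range (e • (LinearMap.id : P →ₗ[R] P))
  have hC₀ : ∀ y z : P, r • y + e • z ∈ C₀ := fun y z =>
    add_mem ((le_sup_left : _ ≤ C₀) ⟨y, rfl⟩) ((le_sup_right : _ ≤ C₀) ⟨z, rfl⟩)
  have hBe : ∀ y ∈ B, e • y = 0 := fun y hy =>
    hext _ _ (by rw [map_smul, hy.1, smul_zero, map_zero])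
      (by rw [map_smul, map_zero]; exact hy.2)
  have he1 : ∀ z : P, (1 - e) • e • z = 0 := fun z => by
    rw [smul_smul, sub_mul, one_mul, he.eq, sub_self, zero_smul]
  have hB1 : ∀ y ∈ B, (1 - e) • y = y := fun y hy =>
    (sub_smul 1 e y).trans (by rw [hBe y hy, one_smul, sub_zero])
  have hd : Disjoint B C₀ := by
    rw [Submodule.disjoint_def]
    intro b hb hb'
    obtain ⟨_, ⟨y, rfl⟩, _, ⟨z, rfl⟩, h⟩ := Submodule.mem_sup.1 hb'
    have hb1 := hB1 b hb
    rw [← h] at hb1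
    change (1 - e) • (r • y + e • z) = r • y + e • z at hb1
    rw [smul_add, he1, add_zero, smul_comm] at hb1
    change r • y + e • z = b at h
    rw [h] at hb1
    rw [← hb1]
    refine hkill _ ?_
    rw [← map_smul, hb1]
    exact hb.1
  have hpure : ∀ (s : R) (y : P), s • y ∈ B ⊔ C₀ → ∃ b ∈ B, s • y - s • b ∈ C₀ := by
    intro s y hy
    obtain ⟨b, hb, _, hz, h⟩ := Submodule.mem_sup.1 hy
    obtain ⟨_, ⟨z, rfl⟩, _, ⟨w, rfl⟩, rfl⟩ := Submodule.mem_sup.1 hz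
    change b + (r • z + e • w) = s • y at h
    have hb1 : b = s • (1 - e) • y - r • (1 - e) • z := by
      have := congrArg ((1 - e) • ·) h
      simp only [smul_add, he1, add_zero, hB1 b hb] at this
      rw [smul_comm s, ← this, smul_comm r]
      abel
    have he0 : ∀ t c : R, e • (t • (1 - e) • y - c • (1 - e) • z) = 0 := fun t c => by
      rw [smul_sub, smul_smul, smul_smul, smul_smul, smul_smul,
        show e * t * (1 - e) = 0 by linear_combination -t * he.eq,
        show e * c * (1 - e) = 0 by linear_combination -c * he.eq, zero_smul, zero_smul, sub_zero]
    -- The claim `b ∈ s • B` is local. If `s` divides `r` near `m`, seeming divisibility turns the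
    -- second coordinate of an approximate quotient into torsion; if `r` divides `s`, then `b`
    -- vanishes near `m` because `r • P` meets the kernel of `φ` trivially.
    have htop : Submodule.comap (LinearMap.toSpanSingleton R P b) (B.map (s • LinearMap.id)) = ⊤ := by
      refine eq_top_of_forall_isMaximal_exists fun m hm => ?_
      have := hm.isPrime
      obtain ⟨π, hπ⟩ := hR.exists_uniformizer m
      obtain ⟨t, ht, ⟨c, hc⟩ | ⟨c, hc⟩⟩ := hπ.dvd_total s r
      · set w' := t • (1 - e) • y - c • (1 - e) • z with hw'
        have hsw : s • w' = t • b := by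
          rw [hb1, hw', smul_sub, smul_sub, smul_smul, smul_smul s c, ← hc, smul_smul t s,
            smul_smul t r, mul_comm s t]
        have hsφ : s • φ w' = 0 := by rw [← map_smul, hsw, map_smul, hb.1, smul_zero]
        have hφt : f (φ (t • w')) = 0 := hf.1 _ (by
          rw [map_smul, smul_smul, mul_comm, hc, mul_comm, mul_smul, hsφ, smul_zero])
        have heψ : e • ψ w' = 0 := by rw [← map_smul, he0, map_zero]
        have hmem : ((0 : M), t • ψ w') ∈ P := (hP _).2 (by
          rw [map_zero, ← map_smul, ← hφψ, hφt])
        refine ⟨t * t, m.primeCompl.mul_mem ht ht, ⟨(0, t • ψ w'), hmem⟩, ⟨rfl, ?_⟩, ?_⟩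
        · change e • t • ψ w' = 0
          rw [smul_comm, heψ, smul_zero]
        · refine hext _ _ ?_ ?_
          · change s • (0 : M) = φ ((t * t) • b)
            rw [map_smul, hb.1, smul_zero, smul_zero]
          · change s • t • ψ w' = ψ ((t * t) • b)
            rw [mul_smul, ← hsw, map_smul, map_smul, smul_comm]
      · refine ⟨t, ht, 0, B.zero_mem, ?_⟩
        have htb : t • b = r • (c • (1 - e) • y - t • (1 - e) • z) := by
          rw [hb1, smul_sub, smul_sub, smul_smul, hc, smul_smul r c, smul_smul t r, smul_smul r t,
            mul_comm r t]
        rw [map_zero]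
        change 0 = t • b
        rw [htb, hkill _ ?_]
        rw [← map_smul, ← htb, map_smul, hb.1, smul_zero]
    obtain ⟨b', hb', hsb⟩ : (1 : R) ∈ Submodule.comap (LinearMap.toSpanSingleton R P b)
      (B.map (s • LinearMap.id)) := htop ▸ Submodule.mem_top
    refine ⟨b', hb', ?_⟩
    have : s • b' = b := by simpa using hsb
    rw [this, ← h, add_sub_cancel_left]
    exact hC₀ z w
  obtain ⟨C, hC, hBC⟩ := exists_isCompl_of_pure
    (hR.hasPureCyclicSubmodules (Ideal.span {r, e})) B C₀ hd (fun j hj y => by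
      obtain ⟨a, b, rfl⟩ := Ideal.mem_span_pair.1 hj
      rw [add_smul, mul_comm a, mul_comm b, mul_smul, mul_smul]
      exact hC₀ _ _) hpure
  let ρ : P →ₗ[R] B := B.projectionOnto C hBC
  -- On the kernel of `φ` the projection is multiplication by `1 - e`, so `κ` descends to `M`.
  -- Multiplied by `r` it agrees with `r • ψ`, since `e * r = 0` and `B` is `r`-torsion.
  let κ : P →ₗ[R] N := (1 - e) • ψ - ψ ∘ₗ B.subtype ∘ₗ ρ
  have hκ : LinearMap.ker φ ≤ LinearMap.ker κ := by
    intro y hy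
    have hy' : (1 - e) • y ∈ B := by
      refine ⟨(map_smul φ _ _).trans (by rw [LinearMap.mem_ker.1 hy, smul_zero]), ?_⟩
      change e • ψ ((1 - e) • y) = 0
      rw [map_smul, smul_smul, mul_sub, mul_one, he.eq, sub_self, zero_smul]
    have hρ : (ρ y : P) = (1 - e) • y := by
      have h1 : y = (1 - e) • y + e • y := by rw [← add_smul, sub_add_cancel, one_smul]
      have h2 : ρ (e • y) = 0 := (Submodule.projectionOnto_apply_eq_zero_iff hBC).2
        (hC (by simpa using hC₀ 0 y))
      have h3 : ρ ((1 - e) • y) = ⟨_, hy'⟩ := Submodule.projectionOnto_apply_left hBC ⟨_, hy'⟩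
      conv_lhs => rw [h1, map_add, h2, add_zero, h3]
    change (1 - e) • ψ y - ψ (ρ y) = 0
    rw [hρ, map_smul, sub_self]
  refine ⟨(LinearMap.ker φ).liftQ κ hκ ∘ₗ (φ.quotKerEquivOfSurjective hφ).symm.toLinearMap,
    LinearMap.ext fun m => ?_⟩
  obtain ⟨y, rfl⟩ := hφ m
  have hsymm : (φ.quotKerEquivOfSurjective hφ).symm (φ y) = Submodule.Quotient.mk y := by
    rw [LinearEquiv.symm_apply_eq]
    rfl
  change f (φ y) = r • (LinearMap.ker φ).liftQ κ hκ ((φ.quotKerEquivOfSurjective hφ).symm (φ y))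
  rw [hsymm, Submodule.liftQ_apply]
  change f (φ y) = r • ((1 - e) • ψ y - ψ (ρ y))
  have h1 : r • ψ (ρ y : P) = 0 := by
    rw [← hφψ, (ρ y).2.1, map_zero]
  rw [smul_sub, h1, sub_zero, smul_smul, mul_sub, mul_one, mul_comm r e, her, sub_zero, hφψ]

theorem seeminglyDivisibleEqDivisible (hR : LocallyPrincipalIdealRing R)
    (hred : NonReducedPointsIsolated R) (hacc : AccumulationPassesDown R) :
    SeeminglyDivisibleEqDivisible.{u, v} R := by
  intro r M N _ _ _ _ f
  refine ⟨fun hf => ?_, ?_⟩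
  · obtain ⟨e, he, her, hez⟩ := exists_idempotent_localZeros hred hacc r
    have : DiscreteTopology (PrimeSpectrum (R ⧸ Ideal.span {r, e})) := by
      refine discreteTopology_of_isolating _ fun p hp => ?_
      have hpz : p ∉ localZeros r := by
        rw [hez]
        exact not_not.2 (hp (Ideal.subset_span (by simp)))
      obtain ⟨t, ht, hts⟩ := exists_isolating_of_not_mem_localZeros hred hacc hpz
      exact ⟨t, ht, fun s hs => hts s (hs (Ideal.subset_span (by simp)))⟩
    exact exists_divisibleInHomBy hR he her hf
  · rintro ⟨g, rfl⟩
    refine ⟨fun m hm => ?_, fun m => ⟨g m, rfl⟩⟩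
    rw [LinearMap.smul_apply, ← map_smul, hm, map_zero]

end Lift

/-- Principality of prime ideals suffices, and an isolated prime is generated by its uniformizer on
its component and by `1` elsewhere. -/
theorem isPrincipalIdealRing_of_discreteTopology {A : Type*} [CommRing A]
    [DiscreteTopology (PrimeSpectrum A)]
    (hA : ∀ p : PrimeSpectrum A, ∃ π, IsUniformizerAt p.asIdeal π) : IsPrincipalIdealRing A := by
  refine IsPrincipalIdealRing.of_prime fun P hP => ?_
  let p : PrimeSpectrum A := ⟨P, hP⟩
  obtain ⟨ε, hε, hp⟩ := exists_idempotent_basicOpen_eq_singleton p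
  obtain ⟨π, hπ⟩ := hA p
  have hεp : ε ∉ P := (hp ▸ Set.mem_singleton p : p ∈ (PrimeSpectrum.basicOpen ε : Set _))
  refine ⟨⟨1 - ε + ε * π, le_antisymm (fun a ha => ?_)
    ((Ideal.span_singleton_le_iff_mem P).2 (add_mem ?_ (P.mul_mem_left ε hπ.mem)))⟩⟩
  · refine Ideal.mem_span_singleton.2 ?_
    obtain ⟨k, c, c', hc, hc'⟩ := hπ.exists_eq_pow hε hp a
    rcases k with _ | k
    · rw [pow_zero, mul_one] at hc'
      exact absurd (hc' ▸ P.mul_mem_left _ ha) hεp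
    · refine ⟨(1 - ε) * a + ε * c * π ^ k, ?_⟩
      linear_combination hc + (c * π ^ k - a + π * a - c * π ^ (k + 1)) * hε.eq
  · refine (hP.mem_or_mem (?_ : ε * (1 - ε) ∈ P)).resolve_left hεp
    rw [mul_sub, mul_one, hε.eq, sub_self]
    exact P.zero_mem

/-! ### Product decompositions from the topological conditions -/

section Forward

variable {R : Type u} [CommRing R]

/-- The product lies in every prime, and a nilpotent idempotent is zero. -/
theorem mul_eq_zero_of_basicOpen_disjoint {e f : R} (he : IsIdempotentElem e)
    (hf : IsIdempotentElem f)
    (h : ∀ p : PrimeSpectrum R, e ∉ p.asIdeal → f ∉ p.asIdeal → False) : e * f = 0 := by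
  have hnil : IsNilpotent (e * f) := nilpotent_iff_mem_prime.2 fun p hp => by
    by_contra hef
    exact h ⟨p, hp⟩ (fun h1 => hef (p.mul_mem_right f h1)) fun h1 => hef (p.mul_mem_left e h1)
  obtain ⟨n, hn⟩ := hnil
  have hef : IsIdempotentElem (e * f) := he.mul hf
  have := hef.pow_succ_eq n
  rw [← this, pow_succ, hn, zero_mul]

theorem mem_span_one_sub_iff {e a : R} (he : IsIdempotentElem e) :
    a ∈ Ideal.span {1 - e} ↔ e * a = 0 := by
  rw [Ideal.mem_span_singleton]
  refine ⟨?_, fun h => ⟨a, by linear_combination h⟩⟩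
  rintro ⟨c, rfl⟩
  linear_combination -c * he.eq

theorem bijective_prod_mk {e₀ e₁ e₂ : R} (h₀ : IsIdempotentElem e₀) (h₁ : IsIdempotentElem e₁)
    (h₂ : IsIdempotentElem e₂) (h01 : e₀ * e₁ = 0) (h02 : e₀ * e₂ = 0) (h12 : e₁ * e₂ = 0)
    (hsum : e₀ + e₁ + e₂ = 1) :
    Function.Bijective ((Ideal.Quotient.mk (Ideal.span {1 - e₀})).prod
      ((Ideal.Quotient.mk (Ideal.span {1 - e₁})).prod (Ideal.Quotient.mk (Ideal.span {1 - e₂})))) := by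
  constructor
  · rw [injective_iff_map_eq_zero]
    intro a ha
    simp only [RingHom.prod_apply, Prod.mk_eq_zero, Ideal.Quotient.eq_zero_iff_mem,
      mem_span_one_sub_iff h₀, mem_span_one_sub_iff h₁, mem_span_one_sub_iff h₂] at ha
    linear_combination ha.1 + ha.2.1 + ha.2.2 - a * hsum
  · rintro ⟨a, b, c⟩
    obtain ⟨a, rfl⟩ := Ideal.Quotient.mk_surjective a
    obtain ⟨b, rfl⟩ := Ideal.Quotient.mk_surjective b
    obtain ⟨c, rfl⟩ := Ideal.Quotient.mk_surjective c
    refine ⟨e₀ * a + e₁ * b + e₂ * c, ?_⟩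
    simp only [RingHom.prod_apply, Prod.mk.injEq, Ideal.Quotient.eq, mem_span_one_sub_iff h₀,
      mem_span_one_sub_iff h₁, mem_span_one_sub_iff h₂]
    refine ⟨?_, ?_, ?_⟩
    · linear_combination a * h₀.eq + b * h01 + c * h02
    · linear_combination b * h₁.eq + a * h01 + c * h12
    · linear_combination c * h₂.eq + a * h02 + b * h12

theorem not_mem_of_one_sub_mem {p : PrimeSpectrum R} {e : R} (h : 1 - e ∈ p.asIdeal) :
    e ∉ p.asIdeal := fun he => p.2.one_notMem (by simpa using add_mem h he)

/-- The points of `V(x)` at which `x` does not vanish locally and `R` is not reduced. -/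
theorem isClopen_nonreduced
    (hred : NonReducedPointsIsolated R) (hacc : AccumulationPassesDown R) (x : R) : IsClopen {p : PrimeSpectrum R | x ∈ p.asIdeal ∧
    p ∉ localZeros x ∧ ¬ IsReduced (Localization.AtPrime p.asIdeal)} := by
  constructor
  · refine isClosed_of_closure_subset fun p hp => ?_
    by_contra hpW
    have hxp : p ∈ PrimeSpectrum.zeroLocus {x} := closure_minimal
      (fun s hs => Set.singleton_subset_iff.2 hs.1) (PrimeSpectrum.isClosed_zeroLocus {x}) hp
    have hpz : p ∉ localZeros x := closure_minimal (t := (localZeros x)ᶜ) (fun s hs => hs.2.1)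
      (isOpen_localZeros x).isClosed_compl hp
    exact not_mem_closure_of_not_mem_localZeros hred hacc hpz hpW
      (fun s hs => Set.singleton_subset_iff.2 hs.1) hp
  · rw [isOpen_iff_forall_mem_open]
    intro p hp
    exact ⟨{p}, Set.singleton_subset_iff.2 hp, hred p hp.2.2, rfl⟩

theorem hasSplittingAt (hR : LocallyPrincipalIdealRing R)
    (hred : NonReducedPointsIsolated R) (hacc : AccumulationPassesDown R) (x : R) : HasSplittingAt R x := by
  obtain ⟨e₀, h₀, hx₀, hZ⟩ := exists_idempotent_localZeros hred hacc x
  obtain ⟨e₂, h₂, hW⟩ := PrimeSpectrum.exists_idempotent_basicOpen_eq_of_isClopen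
    (isClopen_nonreduced hred hacc x)
  have hZ' : ∀ p : PrimeSpectrum R, e₀ ∉ p.asIdeal ↔ p ∈ localZeros x := fun p => by
    rw [hZ]; rfl
  have hW' : ∀ p : PrimeSpectrum R, e₂ ∉ p.asIdeal ↔ x ∈ p.asIdeal ∧
      p ∉ localZeros x ∧ ¬ IsReduced (Localization.AtPrime p.asIdeal) := fun p =>
    (Set.ext_iff.1 hW p).symm
  have h02 : e₀ * e₂ = 0 := mul_eq_zero_of_basicOpen_disjoint h₀ h₂ fun p hp0 hp2 =>
    ((hW' p).1 hp2).2.1 ((hZ' p).1 hp0)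
  set e₁ := 1 - e₀ - e₂ with he₁
  have h₁ : IsIdempotentElem e₁ := by
    change e₁ * e₁ = e₁
    rw [he₁]
    linear_combination h₀.eq + h₂.eq + 2 * h02
  have h01 : e₀ * e₁ = 0 := by rw [he₁]; linear_combination -h₀.eq - h02
  have h12 : e₁ * e₂ = 0 := by rw [he₁]; linear_combination -h₂.eq - h02
  have hpz₁ : ∀ p : PrimeSpectrum R, e₁ ∉ p.asIdeal → p ∉ localZeros x := fun p hp hpz =>
    ((hZ' p).2 hpz) ((p.2.mem_or_mem (h01 ▸ zero_mem _)).resolve_right hp)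
  have hpw₁ : ∀ p : PrimeSpectrum R, e₁ ∉ p.asIdeal → x ∈ p.asIdeal →
      IsReduced (Localization.AtPrime p.asIdeal) := fun p hp hxp => by
    by_contra hr
    exact ((hW' p).2 ⟨hxp, hpz₁ p hp, hr⟩)
      ((p.2.mem_or_mem (h12 ▸ zero_mem _)).resolve_left hp)
  refine ⟨R ⧸ Ideal.span {1 - e₀}, R ⧸ Ideal.span {1 - e₁}, R ⧸ Ideal.span {1 - e₂},
    inferInstance, inferInstance, inferInstance,
    RingEquiv.ofBijective _ (bijective_prod_mk h₀ h₁ h₂ h01 h02 h12 (by rw [he₁]; ring)),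
    Ideal.Quotient.mk _ x, Ideal.Quotient.mk _ x, ?_, ?_, ?_, ?_⟩
  · refine Prod.ext ?_ rfl
    exact Ideal.Quotient.eq_zero_iff_mem.2 ((mem_span_one_sub_iff h₀).2 hx₀)
  · rw [mem_nonZeroDivisors_iff_right]
    intro y hy
    obtain ⟨y, rfl⟩ := Ideal.Quotient.mk_surjective y
    rw [← map_mul, Ideal.Quotient.eq_zero_iff_mem, mem_span_one_sub_iff h₁] at hy
    rw [Ideal.Quotient.eq_zero_iff_mem, mem_span_one_sub_iff h₁]
    refine eq_zero_of_forall_prime_exists fun p => ?_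
    by_cases hp₁ : e₁ ∈ p.asIdeal
    · refine ⟨1 - e₁, fun h => not_mem_of_one_sub_mem h hp₁, ?_⟩
      linear_combination -y * h₁.eq
    by_cases hxp : x ∈ p.asIdeal
    · have := hpw₁ p hp₁ hxp
      obtain ⟨q, hqp, hxq⟩ := exists_prime_le_not_mem (p := p.asIdeal) (x := x)
        fun t ht htx => hpz₁ p hp₁ ⟨t, ht, htx⟩
      obtain ⟨π, hπ⟩ := hR.exists_uniformizer p.asIdeal
      have hπq : π ∉ q.asIdeal := hπ.not_mem_of_lt
        (lt_of_le_of_ne hqp fun h => hxq (h ▸ hxp))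
      -- If `y` were nonzero at `p`, both `x` and `y` would divide powers of `π` locally, so `x * y
      -- = 0` would force `π` into the strictly smaller prime `q`.
      rcases hπ.zero_or_pow y with ⟨t, ht, hty⟩ | ⟨k, t, ht, t', ht', hty⟩
      · exact ⟨t, ht, by linear_combination e₁ * hty⟩
      · exfalso
        obtain ⟨l, s, hs, c, hc⟩ := hπ.pow_of_not_mem hqp hxq
        have h0 : s * t' * e₁ * (π ^ l * π ^ k) = 0 := by
          linear_combination t' * e₁ * π ^ k * hc - c * x * e₁ * hty + c * t * hy
        refine q.asIdeal.primeCompl.mul_mem (q.asIdeal.primeCompl.mul_mem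
          (q.asIdeal.primeCompl.mul_mem (fun h => hs (hqp h)) (fun h => ht' (hqp h)))
          (fun h => hp₁ (hqp h))) (q.asIdeal.primeCompl.mul_mem
          (q.asIdeal.primeCompl.pow_mem hπq l) (q.asIdeal.primeCompl.pow_mem hπq k)) ?_
        rw [h0]
        exact zero_mem _
    · exact ⟨x, hxp, by linear_combination hy⟩
  · have hmem : ∀ s : PrimeSpectrum (R ⧸ Ideal.span {1 - e₁}),
        e₁ ∉ (s.comap (Ideal.Quotient.mk (Ideal.span {1 - e₁}))).asIdeal := fun s => by
      refine not_mem_of_one_sub_mem ?_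
      rw [PrimeSpectrum.comap_asIdeal, Ideal.mem_comap, Ideal.Quotient.eq_zero_iff_mem.2
        (Ideal.mem_span_singleton_self _)]
      exact zero_mem _
    refine discreteTopology_subtype_iff'.2 fun p hp => ?_
    obtain ⟨t, ht, hts⟩ := exists_isolating_of_not_mem_localZeros hred hacc (hpz₁ _ (hmem p))
    let V : Set (PrimeSpectrum (R ⧸ Ideal.span {1 - e₁})) :=
      PrimeSpectrum.basicOpen (Ideal.Quotient.mk (Ideal.span {1 - e₁}) t)
    refine ⟨V, PrimeSpectrum.isOpen_basicOpen,
      Set.eq_of_subset_of_subset ?_ (Set.singleton_subset_iff.2 ⟨ht, hp⟩)⟩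
    rintro s ⟨hs, hxs⟩
    exact PrimeSpectrum.comap_injective_of_surjective _ Ideal.Quotient.mk_surjective
      (hts _ (hxs rfl) hs)
  · have : DiscreteTopology (PrimeSpectrum (R ⧸ Ideal.span {1 - e₂})) := by
      refine discreteTopology_of_isolating _ fun p hp => ?_
      have := hred p ((hW' p).1 (not_mem_of_one_sub_mem
        (hp (Ideal.mem_span_singleton_self _)))).2.2
      obtain ⟨_, ⟨t, rfl⟩, ht, hts⟩ :=
        PrimeSpectrum.isTopologicalBasis_basic_opens.exists_subset_of_mem_open
          (Set.mem_singleton p) this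
      exact ⟨t, ht, fun s _ hs => hts hs⟩
    exact isPrincipalIdealRing_of_discreteTopology
      (hR.exists_uniformizer_of_surjective Ideal.Quotient.mk_surjective)

end Forward

/-! ### Topological conditions from product decompositions -/

section Backward

variable {R : Type u} [CommRing R]

/-- A splitting at `x`, expressed inside `R`. -/
theorem HasSplittingAt.exists_partition {x : R} (h : HasSplittingAt R x) : ∃ e₀ e₁ e₂ : R,
    e₀ + e₁ + e₂ = 1 ∧ e₀ * x = 0 ∧ (∀ y, x * y = 0 → e₁ * y = 0) ∧
    (∀ p : PrimeSpectrum R, e₁ ∉ p.asIdeal → x ∈ p.asIdeal → ∃ t ∉ p.asIdeal,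
      ∀ s : PrimeSpectrum R, e₁ ∉ s.asIdeal → x ∈ s.asIdeal → t ∉ s.asIdeal → s = p) ∧
    ∀ I : Ideal R, ∃ a ∈ I, ∀ b ∈ I, a ∣ e₂ * b := by
  obtain ⟨R₀, R₁, R₂, _, _, _, e, x₁, x₂, hx, hx₁, hd, hP⟩ := h
  refine ⟨e.symm (1, 0, 0), e.symm (0, 1, 0), e.symm (0, 0, 1), ?_, ?_, ?_, ?_, ?_⟩
  · apply e.injective
    simp
  · apply e.injective
    simp [hx]
  · intro y hy
    apply e.injective
    have := congrArg (fun z => (e z).2.1) hy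
    simp only [map_mul, hx, Prod.snd_mul, Prod.fst_mul, map_zero, Prod.snd_zero,
      Prod.fst_zero] at this
    have hy1 := (mem_nonZeroDivisors_iff_right.1 hx₁) _ ((mul_comm _ _).trans this)
    rw [map_mul, e.apply_symm_apply, map_zero]
    ext <;> simp [hy1]
  · let f : R →+* R₁ := (RingHom.fst R₁ R₂).comp ((RingHom.snd R₀ (R₁ × R₂)).comp e)
    have hf : Function.Surjective f := fun a => ⟨e.symm (0, a, 0), by simp [f]⟩
    have hfx : f x = x₁ := by simp [f, hx]
    have hlift : ∀ p : PrimeSpectrum R, e.symm (0, 1, 0) ∉ p.asIdeal →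
        ∃ p' : PrimeSpectrum R₁, p'.comap f = p := fun p hp => by
      have : p ∈ Set.range (PrimeSpectrum.comap f) := by
        rw [range_comap_of_surjective _ f hf]
        intro a ha
        have h0 : a * e.symm (0, 1, 0) = 0 := by
          apply e.injective
          have : (e a).2.1 = 0 := ha
          rw [map_mul, e.apply_symm_apply, map_zero]
          ext <;> simp [this]
        exact (p.2.mem_or_mem (h0 ▸ zero_mem _)).resolve_right hp
      exact this
    intro p hp hxp
    obtain ⟨p, rfl⟩ := hlift p hp
    obtain ⟨U, hU, hUp⟩ := discreteTopology_subtype_iff'.1 hd p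
      (Set.singleton_subset_iff.2 (hfx ▸ hxp))
    obtain ⟨_, ⟨t, rfl⟩, ht, hts⟩ :=
      PrimeSpectrum.isTopologicalBasis_basic_opens.exists_subset_of_mem_open
        (hUp ▸ Set.mem_singleton p : p ∈ U ∩ _).1 hU
    obtain ⟨t, rfl⟩ := hf t
    refine ⟨t, ht, fun s hs hxs hst => ?_⟩
    obtain ⟨s, rfl⟩ := hlift s hs
    have : s ∈ ({p} : Set _) := hUp ▸ ⟨hts hst, Set.singleton_subset_iff.2 (hfx ▸ hxs)⟩
    rw [Set.mem_singleton_iff.1 this]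
  · let f : R →+* R₂ := (RingHom.snd R₁ R₂).comp ((RingHom.snd R₀ (R₁ × R₂)).comp e)
    have hf : Function.Surjective f := fun a => ⟨e.symm (0, 0, a), by simp [f]⟩
    intro I
    obtain ⟨g, hg⟩ := hP.principal (I.map f)
    obtain ⟨a, ha, hag⟩ := (Ideal.mem_map_iff_of_surjective f hf).1
      (hg ▸ Ideal.mem_span_singleton_self g : g ∈ I.map f)
    refine ⟨a, ha, fun b hb => ?_⟩
    obtain ⟨c, hc⟩ := Ideal.mem_span_singleton.1 (hg ▸ Ideal.mem_map_of_mem f hb)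
    obtain ⟨c, rfl⟩ := hf c
    refine ⟨e.symm (0, 0, 1) * c, e.injective ?_⟩
    have : (e b).2.2 = (e a).2.2 * (e c).2.2 := by rw [← hag] at hc; exact hc
    simp only [map_mul, e.apply_symm_apply]
    ext <;> simp [this]

theorem exists_not_mem_of_sum_eq_one {p : Ideal R} [hp : p.IsPrime] {e₀ e₁ e₂ : R}
    (h : e₀ + e₁ + e₂ = 1) : e₀ ∉ p ∨ e₁ ∉ p ∨ e₂ ∉ p := by
  by_contra! hall
  exact hp.one_notMem (h ▸ add_mem (add_mem hall.1 hall.2.1) hall.2.2)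

/-- Split at the uniformizer `π`, which is nonzero but nilpotent at `p`: this rules out the factors
where it is zero or a non-zero-divisor. In the principal factor `p` has one generator, which `π`
divides locally, so near `p` every prime contains `p`. -/
theorem nonReducedPointsIsolated_of_hasSplittingAt
    (hR : LocallyPrincipalIdealRing R) (hS : ∀ x : R, HasSplittingAt R x) : NonReducedPointsIsolated R := by
  intro p hred
  have hmax := hR.isMaximal_of_not_isReduced hred
  obtain ⟨π, hπ⟩ := hR.exists_uniformizer p.asIdeal
  obtain ⟨n, t, ht, htn⟩ := hπ.exists_mul_pow_eq_zero hred
  obtain ⟨e₀, e₁, e₂, hsum, h0, h1, -, h2⟩ := (hS π).exists_partition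
  rcases exists_not_mem_of_sum_eq_one (p := p.asIdeal) hsum with hp | hp | hp
  · exact absurd h0 (hπ.mul_ne_zero_of_not_isReduced hred hp)
  · exfalso
    have : ∀ n : ℕ, ∀ t ∉ p.asIdeal, t * π ^ n ≠ 0 := by
      intro n
      induction n with
      | zero => exact fun t ht h => ht (by rw [pow_zero, mul_one] at h; exact h ▸ zero_mem _)
      | succ n ih =>
        intro t ht h
        refine ih (e₁ * t) (p.asIdeal.primeCompl.mul_mem hp ht) ?_
        rw [mul_assoc]
        exact h1 _ (by linear_combination h)
    exact this n t ht htn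
  · obtain ⟨a, ha, hab⟩ := h2 p.asIdeal
    obtain ⟨r, hr, c, hc⟩ := hπ.exists_dvd_mul ha
    have : ({p} : Set (PrimeSpectrum R)) = PrimeSpectrum.basicOpen (e₂ * t * r) := by
      refine Set.eq_of_subset_of_subset (Set.singleton_subset_iff.2 (p.asIdeal.primeCompl.mul_mem
        (p.asIdeal.primeCompl.mul_mem hp ht) hr)) fun s hs => ?_
      have hes : e₂ ∉ s.asIdeal := fun h =>
        hs (s.asIdeal.mul_mem_right r (s.asIdeal.mul_mem_right t h))
      have hts : t ∉ s.asIdeal := fun h =>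
        hs (s.asIdeal.mul_mem_right r (s.asIdeal.mul_mem_left e₂ h))
      have hrs : r ∉ s.asIdeal := fun h => hs (s.asIdeal.mul_mem_left _ h)
      have hπs : π ∈ s.asIdeal :=
        s.2.mem_of_pow_mem n ((s.2.mem_or_mem (htn ▸ zero_mem _)).resolve_left hts)
      have has : a ∈ s.asIdeal := (s.2.mem_or_mem
        (hc ▸ s.asIdeal.mul_mem_right c hπs)).resolve_left hrs
      exact (PrimeSpectrum.ext (hmax.eq_of_le s.2.ne_top fun b hb =>
        (s.2.mem_or_mem (s.asIdeal.mem_of_dvd (hab b hb) has)).resolve_left hes)).symm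
    rw [this]
    exact PrimeSpectrum.isOpen_basicOpen

/-- Split at some `x ∉ q` vanishing on `S`. The zero factor is impossible as `x ∉ q`. In the middle
factor `p` is isolated in `V(x)`. In the principal factor `x` divides a power of the uniformizer
locally, so points of `S` near `p` contain the maximal ideal `p`. -/
theorem accumulationPassesDown_of_hasSplittingAt
    (hR : LocallyPrincipalIdealRing R) (hS : ∀ x : R, HasSplittingAt R x) : AccumulationPassesDown R := by
  intro p q S hpS hacc hqp
  rcases eq_or_ne q p with rfl | hne
  · exact hacc
  intro U hU hqU
  by_contra hempty
  have hlt : q.asIdeal < p.asIdeal := lt_of_le_of_ne hqp fun h => hne (PrimeSpectrum.ext h)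
  have hmax := hR.isMaximal_of_lt hlt
  obtain ⟨_, ⟨x, rfl⟩, hxq, hxU⟩ :=
    PrimeSpectrum.isTopologicalBasis_basic_opens.exists_subset_of_mem_open hqU hU
  have hxS : ∀ s ∈ S, x ∈ s.asIdeal := fun s hs => by
    by_contra hxs
    exact hempty ⟨s, hxU hxs, hs⟩
  have hxp : x ∈ p.asIdeal := by
    by_contra hxp
    obtain ⟨s, hs, hsS⟩ := hacc _ (PrimeSpectrum.isOpen_basicOpen (a := x)) hxp
    exact hs (hxS s hsS)
  obtain ⟨e₀, e₁, e₂, hsum, h0, -, h1, h2⟩ := (hS x).exists_partition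
  rcases exists_not_mem_of_sum_eq_one (p := p.asIdeal) hsum with hp | hp | hp
  · exact ((q.2.mem_or_mem (h0 ▸ zero_mem _)).elim (fun h => hp (hqp h)) hxq).elim
  · obtain ⟨t, ht, hts⟩ := h1 p hp hxp
    obtain ⟨s, hs, hsS⟩ := hacc _ (PrimeSpectrum.isOpen_basicOpen (a := e₁ * t))
      (p.asIdeal.primeCompl.mul_mem hp ht)
    exact hpS (hts s (fun h => hs (s.asIdeal.mul_mem_right t h)) (hxS s hsS)
      (fun h => hs (s.asIdeal.mul_mem_left e₁ h)) ▸ hsS)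
  · obtain ⟨π, hπ⟩ := hR.exists_uniformizer p.asIdeal
    obtain ⟨k, t, ht, htk⟩ := hπ.pow_of_not_mem hqp hxq
    obtain ⟨a, ha, hab⟩ := h2 p.asIdeal
    obtain ⟨r, hr, c, hc⟩ := hπ.exists_dvd_mul ha
    obtain ⟨s, hs, hsS⟩ := hacc _ (PrimeSpectrum.isOpen_basicOpen (a := e₂ * t * r))
      (p.asIdeal.primeCompl.mul_mem (p.asIdeal.primeCompl.mul_mem hp ht) hr)
    have hes : e₂ ∉ s.asIdeal := fun h =>
      hs (s.asIdeal.mul_mem_right r (s.asIdeal.mul_mem_right t h))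
    have hts : t ∉ s.asIdeal := fun h =>
      hs (s.asIdeal.mul_mem_right r (s.asIdeal.mul_mem_left e₂ h))
    have hrs : r ∉ s.asIdeal := fun h => hs (s.asIdeal.mul_mem_left _ h)
    have hπs : π ∈ s.asIdeal := s.2.mem_of_pow_mem k
      ((s.2.mem_or_mem (s.asIdeal.mem_of_dvd htk (hxS s hsS))).resolve_left hts)
    have has : a ∈ s.asIdeal := (s.2.mem_or_mem
      (hc ▸ s.asIdeal.mul_mem_right c hπs)).resolve_left hrs
    have : p = s := PrimeSpectrum.ext (hmax.eq_of_le s.2.ne_top fun b hb =>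
      (s.2.mem_or_mem (s.asIdeal.mem_of_dvd (hab b hb) has)).resolve_left hes)
    exact hpS (this ▸ hsS)

end Backward

theorem mainTheorem1 (R : Type u) [CommRing R] :
    List.TFAE [
      SeeminglyDivisibleEqDivisible.{u, v} R,
      LocallyPrincipalIdealRing R ∧ ∀ x : R, HasSplittingAt R x,
      LocallyPrincipalIdealRing R ∧ NonReducedPointsIsolated R ∧ AccumulationPassesDown R] := by
  tfae_have 1 → 3 := fun h =>
    have h' := h.seemingDivisorsLift
    ⟨h'.locallyPrincipalIdealRing, h'.nonReducedPointsIsolated, h'.accumulationPassesDown⟩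
  tfae_have 3 → 1 := fun ⟨h, h', h''⟩ => seeminglyDivisibleEqDivisible h h' h''
  tfae_have 3 → 2 := fun ⟨h, h', h''⟩ => ⟨h, hasSplittingAt h h' h''⟩
  tfae_have 2 → 3 := fun ⟨h, h'⟩ => ⟨h, nonReducedPointsIsolated_of_hasSplittingAt h h',
    accumulationPassesDown_of_hasSplittingAt h h'⟩
  tfae_finish
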